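/- Let $(M,I,\omega,\nabla)$ be a special Kähler manifold: $(M,I)$ is a complex manifold, $\omega$ is a Kähler form (a closed, nondegenerate, $I$-invariant real 2-form; the associated metric $g=\omega(\cdot,I\cdot)$ may be indefinite), and $\nabla$ is a flat, torsion-free linear connection on the real tangent bundle $TM$ with $d_\nabla I=0$ and $\nabla\omega=0$. Let $D$ be the Levi-Civita connection of $g$, and extend $\nabla$ and $D$ complex linearly to $T^{\mathbb C}M=T^{1,0}\oplus T^{0,1}$. Let $A$ be the component of type $(1,0)$ of the $\mathrm{End}(T^{\mathbb C}M)$-valued 1-form $\nabla-D$ and let $\bar A$ be its complex conjugate. Write $d_D=\partial_D+\bar\partial_D$ for the decomposition by type of the exterior covariant derivative of $D$ on $\mathrm{End}(T^{\mathbb C}M)$-valued forms, put $\bar\partial=\bar\partial_D$, and let $R_D$ be the curvature of $D$ on $T^{\mathbb C}M$. Then: 1. $\nabla-D=A+\bar A$, and $A\in\Omega^{1,0}(\mathrm{Hom}(T^{1,0},T^{0,1}))$, that is, $A$ is a form of type $(1,0)$ that maps $T^{1,0}$ to $T^{0,1}$ and vanishes on $T^{0,1}$. 2. $\partial_D A=0$,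 $\ \bar\partial\bar A=0$, $\ \bar\partial A=0$, $\ \partial_D\bar A=0$, and $R_D+A\wedge\bar A+\bar A\wedge A=0$. 3. The $(0,1)$-part $D^{0,1}$ of $D$ is a Cauchy–Riemann operator with $(D^{0,1})^2=0$, so it defines a holomorphic structure on the complex vector bundle $T^{\mathbb C}M$, and on $T^{1,0}$ it is the $\bar\partial$-operator of the holomorphic tangent bundle: $D_{\bar Z}W=[\bar Z,W]^{1,0}$ for sections $\bar Z$ of $T^{0,1}$ and $W$ of $T^{1,0}$. For this structure $A$ is a Higgs field on $T^{\mathbb C}M$: it is a smooth $\mathrm{End}(T^{\mathbb C}M)$-valued $(1,0)$-form which is holomorphic, and $A\wedge A=0$. -/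

import Mathlib

open scoped Manifold ContDiff TensorProduct

/-- A complex manifold is, with the same charts, a real (analytic) manifold. -/
instance IsManifold.realOfComplex {E : Type*} [NormedAddCommGroup E] [NormedSpace ℂ E]
    {M : Type*} [TopologicalSpace M] [ChartedSpace E M] [IsManifold 𝓘(ℂ, E) ω M] :
    IsManifold 𝓘(ℝ, E) ω M := by
  apply isManifold_of_contDiffOn
  intro e e' he he'
  have h := (contDiffGroupoid ω 𝓘(ℂ, E)).compatible he he'
  rw [contDiffGroupoid, mem_groupoid_of_pregroupoid] at h
  exact ContDiffOn.restrict_scalars ℝ h.1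

namespace SpecialKahler

noncomputable section

/-! ### Real tensor calculus on a complex manifold

`M` is a complex manifold modelled on the finite dimensional complex vector space `E`.
Its real tangent bundle is the tangent bundle of the underlying real manifold, so that each
real tangent space `TangentSpace 𝓘(ℝ, E) x` is `E`, read in the preferred chart at `x`. -/

section

variable (E : Type*) [NormedAddCommGroup E] [NormedSpace ℂ E]
  {M : Type*} [TopologicalSpace M] [ChartedSpace E M]

/-- The complex structure `I` of `M` on the real tangent space at `x`: multiplication by the
imaginary unit in the preferred (holomorphic) chart at `x`. As coordinate changes are holomorphic,
any other holomorphic chart gives the same endomorphism. -/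
def cplxStr (x : M) : TangentSpace 𝓘(ℝ, E) x →ₗ[ℝ] TangentSpace 𝓘(ℝ, E) x :=
  show E →ₗ[ℝ] E from (Complex.I • (LinearMap.id : E →ₗ[ℂ] E)).restrictScalars ℝ

/-- The complexified tangent space `T_x^ℂ M`. -/
abbrev TC (x : M) : Type _ := ℂ ⊗[ℝ] TangentSpace 𝓘(ℝ, E) x

/-- The real part of a complex tangent vector. -/
def re (x : M) : TC E x →ₗ[ℝ] TangentSpace 𝓘(ℝ, E) x :=
  (TensorProduct.lid ℝ _).toLinearMap ∘ₗ Complex.reLm.rTensor _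

/-- The imaginary part of a complex tangent vector. -/
def im (x : M) : TC E x →ₗ[ℝ] TangentSpace 𝓘(ℝ, E) x :=
  (TensorProduct.lid ℝ _).toLinearMap ∘ₗ Complex.imLm.rTensor _

/-- Complex conjugation on `T_x^ℂ M`. -/
def conjTC (x : M) : TC E x →ₗ[ℝ] TC E x :=
  Complex.conjAe.toLinearMap.rTensor _

theorem conjTC_smul (x : M) (c : ℂ) (v : TC E x) :
    conjTC E x (c • v) = (starRingEnd ℂ) c • conjTC E x v := by
  induction v using TensorProduct.induction_on with
  | zero => simp
  | tmul a u => simp [conjTC, TensorProduct.smul_tmul']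
  | add v w hv hw => rw [smul_add, map_add, hv, hw, map_add, smul_add]

/-- The projection of `T_x^ℂ M` onto `T_x^{1,0}`, the `i`-eigenspace of the complex structure. -/
def pi10 (x : M) : TC E x →ₗ[ℂ] TC E x :=
  (1 / 2 : ℂ) • (LinearMap.id - Complex.I • (cplxStr E x).baseChange ℂ)

/-- The projection of `T_x^ℂ M` onto `T_x^{0,1}`, the `-i`-eigenspace of the complex structure. -/
def pi01 (x : M) : TC E x →ₗ[ℂ] TC E x :=
  (1 / 2 : ℂ) • (LinearMap.id + Complex.I • (cplxStr E x).baseChange ℂ)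

/-- The subspace `T_x^{1,0}` of `T_x^ℂ M`. -/
def T10 (x : M) : Submodule ℂ (TC E x) :=
  LinearMap.ker ((cplxStr E x).baseChange ℂ - Complex.I • LinearMap.id)

/-- The subspace `T_x^{0,1}` of `T_x^ℂ M`. -/
def T01 (x : M) : Submodule ℂ (TC E x) :=
  LinearMap.ker ((cplxStr E x).baseChange ℂ + Complex.I • LinearMap.id)

end

section

variable (E : Type*) [NormedAddCommGroup E] [NormedSpace ℂ E]
  (M : Type*) [TopologicalSpace M] [ChartedSpace E M]

/-- Real vector fields on `M`. -/
abbrev VF := Π x : M, TangentSpace 𝓘(ℝ, E) x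

/-- Complex vector fields on `M`, that is, sections of `T^ℂ M`. -/
abbrev CVF := Π x : M, TC E x

/-- Real bilinear forms on the tangent spaces of `M`. -/
abbrev BilinField := Π x : M, LinearMap.BilinForm ℝ (TangentSpace 𝓘(ℝ, E) x)

/-- Complex 1-forms with values in `End(T^ℂ M)`: `α x v w` is `α_v w`, with `v` the argument of
the form. -/
abbrev EndForm1 := Π x : M, TC E x →ₗ[ℂ] TC E x →ₗ[ℂ] TC E x

/-- Complex 2-forms with values in `End(T^ℂ M)`, given by their action on complex vector fields:
`F Z W S` is `F(Z, W) S`. -/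
abbrev EndForm2 := CVF E M → CVF E M → CVF E M → CVF E M

end

section

variable {E : Type*} [NormedAddCommGroup E] [NormedSpace ℂ E]
  {M : Type*} [TopologicalSpace M] [ChartedSpace E M]

/-- The derivative `X f` of a real function `f` along a vector field `X`. -/
def dirDeriv (X : VF E M) (f : M → ℝ) (x : M) : ℝ := mvfderiv 𝓘(ℝ, E) f x (X x)

/-- The Lie bracket of real vector fields. -/
abbrev bracket (X Y : VF E M) : VF E M := VectorField.mlieBracket 𝓘(ℝ, E) X Y

/-- The bracket of complex vector fields, extended complex bilinearly from real ones. -/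
def bracketC (Z W : CVF E M) : CVF E M := fun x =>
  let Z₁ : VF E M := fun y => re E y (Z y)
  let Z₂ : VF E M := fun y => im E y (Z y)
  let W₁ : VF E M := fun y => re E y (W y)
  let W₂ : VF E M := fun y => im E y (W y)
  (1 : ℂ) ⊗ₜ[ℝ] (bracket Z₁ W₁ x - bracket Z₂ W₂ x) +
    Complex.I ⊗ₜ[ℝ] (bracket Z₁ W₂ x + bracket Z₂ W₁ x)

/-- The differential at `x` of a complex function, extended complex linearly to `T_x^ℂ M`. -/
def dC (f : M → ℂ) (x : M) (v : TC E x) : ℂ :=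
  mvfderiv 𝓘(ℝ, E) f x (re E x v) + Complex.I * mvfderiv 𝓘(ℝ, E) f x (im E x v)

/-- `I X` for a vector field `X`. -/
def applyI (X : VF E M) : VF E M := fun x => cplxStr E x (X x)

/-- The `(1,0)`-component of a complex vector field. -/
def proj10 (Z : CVF E M) : CVF E M := fun x => pi10 E x (Z x)

/-- The `(0,1)`-component of a complex vector field. -/
def proj01 (Z : CVF E M) : CVF E M := fun x => pi01 E x (Z x)

end

/-! ### Special Kähler manifolds -/

section

variable (E : Type*) [NormedAddCommGroup E] [NormedSpace ℂ E]
  (M : Type*) [TopologicalSpace M] [ChartedSpace E M] [IsManifold 𝓘(ℂ, E) ω M]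

/-- Linear connections on the real tangent bundle of `M`; `D Y x (X x)` is `(D_X Y)(x)`. -/
abbrev Conn := CovariantDerivative 𝓘(ℝ, E) E (TangentSpace 𝓘(ℝ, E) : M → Type _)

end

section

variable {E : Type*} [NormedAddCommGroup E] [NormedSpace ℂ E]
  {M : Type*} [TopologicalSpace M] [ChartedSpace E M] [IsManifold 𝓘(ℂ, E) ω M]

/-- A real vector field is smooth. -/
def SmoothVF (X : VF E M) : Prop :=
  ContMDiff 𝓘(ℝ, E) 𝓘(ℝ, E).tangent ∞
    (fun x => (⟨x, X x⟩ : Bundle.TotalSpace E (TangentSpace 𝓘(ℝ, E) : M → Type _)))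

/-- A complex vector field is smooth. -/
def SmoothCVF (Z : CVF E M) : Prop :=
  SmoothVF (fun x => re E x (Z x)) ∧ SmoothVF (fun x => im E x (Z x))

/-- The vector field `D_X Y`. -/
def along (D : Conn E M) (X Y : VF E M) : VF E M := fun x => D Y x (X x)

/-- The curvature `R_D(X, Y) Z = D_X D_Y Z - D_Y D_X Z - D_{[X, Y]} Z`. -/
def curv (D : Conn E M) (X Y Z : VF E M) : VF E M :=
  along D X (along D Y Z) - along D Y (along D X Z) - along D (bracket X Y) Z

/-- The connection `D` is flat. -/
def IsFlat (D : Conn E M) : Prop :=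
  ∀ X Y Z : VF E M, SmoothVF X → SmoothVF Y → SmoothVF Z → curv D X Y Z = 0

/-- The connection `D` is torsion free. -/
def IsTorsionFree [FiniteDimensional ℂ E] (D : Conn E M) : Prop :=
  haveI : CompleteSpace E := FiniteDimensional.complete ℂ E
  D.torsion = 0

/-- The exterior covariant derivative of the complex structure, seen as a 1-form with values in
the tangent bundle: `d_D I (X, Y) = D_X (I Y) - D_Y (I X) - I [X, Y]`. -/
def extCovI (D : Conn E M) (X Y : VF E M) : VF E M :=
  along D X (applyI Y) - along D Y (applyI X) - applyI (bracket X Y)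

/-- The bilinear form `b` is parallel: `v (b(Y, Z)) = b(D_v Y, Z) + b(Y, D_v Z)`. -/
def IsParallel (D : Conn E M) (b : BilinField E M) : Prop :=
  ∀ X Y Z : VF E M, SmoothVF X → SmoothVF Y → SmoothVF Z → ∀ x,
    dirDeriv X (fun y => b y (Y y) (Z y)) x =
      b x (along D X Y x) (Z x) + b x (Y x) (along D X Z x)

/-- `Ω` is a (possibly indefinite) Kähler form: a smooth real 2-form that is nondegenerate,
`I`-invariant and closed. -/
structure IsKahlerForm (Ω : BilinField E M) : Prop where
  smooth : ∀ X Y : VF E M, SmoothVF X → SmoothVF Y →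
    ContMDiff 𝓘(ℝ, E) 𝓘(ℝ, ℝ) ∞ (fun x => Ω x (X x) (Y x))
  alt : ∀ x v, Ω x v v = 0
  nondegenerate : ∀ x v, (∀ w, Ω x v w = 0) → v = 0
  invariant : ∀ x v w, Ω x (cplxStr E x v) (cplxStr E x w) = Ω x v w
  closed : ∀ X Y Z : VF E M, SmoothVF X → SmoothVF Y → SmoothVF Z → ∀ x,
    dirDeriv X (fun y => Ω y (Y y) (Z y)) x - dirDeriv Y (fun y => Ω y (X y) (Z y)) x
      + dirDeriv Z (fun y => Ω y (X y) (Y y)) x - Ω x (bracket X Y x) (Z x)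
      + Ω x (bracket X Z x) (Y x) - Ω x (bracket Y Z x) (X x) = 0

/-- The (pseudo-)Riemannian metric `g(v, w) = Ω(v, I w)` of a Kähler form `Ω`. -/
def kahlerMetric (Ω : BilinField E M) : BilinField E M := fun x =>
  (Ω x).compl₂ (cplxStr E x)

/-- `D` is the Levi-Civita connection of `g`. -/
structure IsLeviCivita [FiniteDimensional ℂ E] (g : BilinField E M) (D : Conn E M) : Prop where
  smooth : CovariantDerivative.ContMDiffCovariantDerivative D ∞
  torsionFree : IsTorsionFree D
  metric : IsParallel D g

/-- `(M, I, Ω, nabla)` is a special (possibly indefinite) Kähler manifold. -/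
structure IsSpecialKahler [FiniteDimensional ℂ E] (Ω : BilinField E M) (nabla : Conn E M) :
    Prop where
  kahler : IsKahlerForm Ω
  smooth : CovariantDerivative.ContMDiffCovariantDerivative nabla ∞
  flat : IsFlat nabla
  torsionFree : IsTorsionFree nabla
  extCovI_eq_zero : ∀ X Y : VF E M, SmoothVF X → SmoothVF Y → extCovI nabla X Y = 0
  parallel : IsParallel nabla Ω

/-! ### Forms with values in `End(T^ℂ M)` -/

/-- The covariant derivative `v ↦ D_v S` of a complex vector field `S`, for the complex linear
extension of the connection `D` to `T^ℂ M`. -/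
def covC (D : Conn E M) (S : CVF E M) (x : M) : TC E x →ₗ[ℂ] TC E x :=
  (D (fun y => re E y (S y)) x).toLinearMap.baseChange ℂ +
    Complex.I • (D (fun y => im E y (S y)) x).toLinearMap.baseChange ℂ

/-- The complex vector field `D_Z S`. -/
def alongC (D : Conn E M) (Z S : CVF E M) : CVF E M := fun x => covC D S x (Z x)

/-- The `(0,1)`-part `v ↦ D_{v^{0,1}} S` of the connection `D` on `T^ℂ M`. -/
def cov01 (D : Conn E M) (S : CVF E M) (x : M) : TC E x →ₗ[ℂ] TC E x :=
  covC D S x ∘ₗ pi01 E x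

/-- The curvature `R_D` of the connection `D` on `T^ℂ M`. -/
def curvC (D : Conn E M) : EndForm2 E M := fun Z W S =>
  alongC D Z (alongC D W S) - alongC D W (alongC D Z S) - alongC D (bracketC Z W) S

/-- The vector field `α_W S`. -/
def EndForm1.act (α : EndForm1 E M) (W S : CVF E M) : CVF E M := fun x => α x (W x) (S x)

/-- The component `α^{1,0}` of a 1-form: `v ↦ α(v^{1,0})`. -/
def EndForm1.part10 (α : EndForm1 E M) : EndForm1 E M := fun x => α x ∘ₗ pi10 E x

/-- The component `α^{0,1}` of a 1-form: `v ↦ α(v^{0,1})`. -/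
def EndForm1.part01 (α : EndForm1 E M) : EndForm1 E M := fun x => α x ∘ₗ pi01 E x

/-- The complex conjugate of a 1-form: `ᾱ_v w` is the conjugate of `α_{v̄} w̄`. -/
def EndForm1.conj (α : EndForm1 E M) : EndForm1 E M := fun x =>
  LinearMap.mk₂ ℂ (fun v w => conjTC E x (α x (conjTC E x v) (conjTC E x w)))
    (by intros; simp) (by intros; simp [conjTC_smul])
    (by intros; simp) (by intros; simp [conjTC_smul])

/-- The wedge product (with composition of endomorphisms) at a point:
`(α ∧ β)(v, w) = α_v β_w - α_w β_v`. -/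
def wedgeAt (α β : EndForm1 E M) (x : M) (v w : TC E x) : TC E x →ₗ[ℂ] TC E x :=
  α x v ∘ₗ β x w - α x w ∘ₗ β x v

/-- The wedge product `α ∧ β`. -/
def wedge (α β : EndForm1 E M) : EndForm2 E M := fun Z W S x =>
  wedgeAt α β x (Z x) (W x) (S x)

/-- The exterior covariant derivative
`(d_D α)(Z, W) = [D_Z, α_W] - [D_W, α_Z] - α_{[Z, W]}` for the connection that `D` induces on
`End(T^ℂ M)`. -/
def extCov (D : Conn E M) (α : EndForm1 E M) : EndForm2 E M := fun Z W S =>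
  (alongC D Z (α.act W S) - α.act W (alongC D Z S))
    - (alongC D W (α.act Z S) - α.act Z (alongC D W S)) - α.act (bracketC Z W) S

/-- The component of type `(2,0)` of a 2-form. -/
def EndForm2.part20 (F : EndForm2 E M) : EndForm2 E M := fun Z W S =>
  F (proj10 Z) (proj10 W) S

/-- The component of type `(1,1)` of a 2-form. -/
def EndForm2.part11 (F : EndForm2 E M) : EndForm2 E M := fun Z W S =>
  F (proj10 Z) (proj01 W) S + F (proj01 Z) (proj10 W) S

/-- The component of type `(0,2)` of a 2-form. -/
def EndForm2.part02 (F : EndForm2 E M) : EndForm2 E M := fun Z W S =>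
  F (proj01 Z) (proj01 W) S

/-- The operator `∂_D` on 1-forms: on type `(p,q)` it is the component of type `(p+1,q)` of
`d_D`. -/
def del (D : Conn E M) (α : EndForm1 E M) : EndForm2 E M :=
  EndForm2.part20 (extCov D α.part10) + EndForm2.part11 (extCov D α.part01)

/-- The operator `∂̄_D` on 1-forms: on type `(p,q)` it is the component of type `(p,q+1)` of
`d_D`. -/
def delbar (D : Conn E M) (α : EndForm1 E M) : EndForm2 E M :=
  EndForm2.part11 (extCov D α.part10) + EndForm2.part02 (extCov D α.part01)

/-- The 2-form `F` is zero. -/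
def EndForm2.Vanishes (F : EndForm2 E M) : Prop :=
  ∀ Z W S : CVF E M, SmoothCVF Z → SmoothCVF W → SmoothCVF S → F Z W S = 0

/-- The complex bilinear extension to `T^ℂ M` of the 1-form `nabla - D` with values in `End(TM)`:
for real vector fields `X, Y` its value is `nabla_X Y - D_X Y`. -/
def diffForm [FiniteDimensional ℂ E] (nabla D : Conn E M) : EndForm1 E M := fun x =>
  let a : LinearMap.BilinMap ℝ (TangentSpace 𝓘(ℝ, E) x) (TangentSpace 𝓘(ℝ, E) x) :=
    LinearMap.mk₂ ℝ (fun v w => nabla.difference D x w v)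
      (by intros; simp) (by intros; simp) (by intros; simp) (by intros; simp)
  LinearMap.BilinMap.baseChange ℂ a

/-- The form `A`: the component of type `(1,0)` of `nabla - D`. -/
def higgsForm [FiniteDimensional ℂ E] (nabla D : Conn E M) : EndForm1 E M :=
  (diffForm nabla D).part10

/-! ### Holomorphic structures and Higgs fields on `T^ℂ M` -/

/-- `dbar` is a holomorphic structure on the complex vector bundle `T^ℂ M`, given by its
Cauchy-Riemann operator (`dbar S x v` is `(∂̄ S)(v)`): a differential operator from sections to
sections with values in `(0,1)`-forms that satisfies the Leibniz rule and has square zero. -/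
structure IsHolomorphicStructure (dbar : CVF E M → Π x : M, TC E x →ₗ[ℂ] TC E x) : Prop where
  type01 : ∀ S : CVF E M, SmoothCVF S → ∀ x, ∀ v ∈ T10 E x, dbar S x v = 0
  smooth : ∀ S Z : CVF E M, SmoothCVF S → SmoothCVF Z → SmoothCVF (fun x => dbar S x (Z x))
  add : ∀ S S' : CVF E M, SmoothCVF S → SmoothCVF S' → dbar (S + S') = dbar S + dbar S'
  leibniz : ∀ (f : M → ℂ) (S : CVF E M), ContMDiff 𝓘(ℝ, E) 𝓘(ℝ, ℂ) ∞ f → SmoothCVF S → ∀ x, ∀ v ∈ T01 E x,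
    dbar (fun y => f y • S y) x v = dC f x v • S x + f x • dbar S x v
  integrable : ∀ Z W S : CVF E M, SmoothCVF Z → SmoothCVF W → SmoothCVF S →
    (∀ x, Z x ∈ T01 E x) → (∀ x, W x ∈ T01 E x) → ∀ x,
    dbar (fun y => dbar S y (W y)) x (Z x) - dbar (fun y => dbar S y (Z y)) x (W x)
      - dbar S x (bracketC Z W x) = 0

/-- `φ` is a Higgs field on the bundle `T^ℂ M` with the holomorphic structure `dbar`: a smooth
`End(T^ℂ M)`-valued form of type `(1,0)` that is holomorphic (for the holomorphic structure that
`dbar` and the complex structure of `M` induce on `End(T^ℂ M)`-valued `(1,0)`-forms) and satisfies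
`φ ∧ φ = 0`. -/
structure IsHiggsField (dbar : CVF E M → Π x : M, TC E x →ₗ[ℂ] TC E x) (φ : EndForm1 E M) :
    Prop where
  type10 : ∀ x, ∀ v ∈ T01 E x, φ x v = 0
  smooth : ∀ Z S : CVF E M, SmoothCVF Z → SmoothCVF S → SmoothCVF (φ.act Z S)
  holomorphic : ∀ Z W S : CVF E M, SmoothCVF Z → SmoothCVF W → SmoothCVF S →
    (∀ x, Z x ∈ T01 E x) → (∀ x, W x ∈ T10 E x) → ∀ x,
    dbar (φ.act W S) x (Z x) - φ x (W x) (dbar S x (Z x))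
      - φ x (pi10 E x (bracketC Z W x)) (S x) = 0
  wedge_self : ∀ x v w, wedgeAt φ φ x v w = 0

end

end

end SpecialKahler

namespace SpecialKahler

noncomputable section

section

variable {E : Type*} [NormedAddCommGroup E] [NormedSpace ℂ E]
  {M : Type*} [TopologicalSpace M] [ChartedSpace E M]

/-! ### Smooth real vector fields -/

/-! Everything follows from the formula `D = (nabla - I nabla I) / 2`. The right-hand side is
torsion free because `nabla` is and `d_nabla I = 0` (`complexAverage_torsion`), and it preserves `g`
because `nabla` preserves `Ω` (`dirDeriv_kahlerMetric`); uniqueness of the Levi-Civita connection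
then gives the formula (`along_eq`). Consequently `D` commutes with `I`, while `a = nabla - D =
(nabla + I nabla I) / 2` anticommutes with it. Both connections are torsion free, so `a` is also
symmetric: `a_X Y = a_Y X`.

Flatness of `nabla = D + a` reads `(R_D + a ∧ a) + d_D a = 0`. The first summand commutes with `I`
and the second anticommutes, so each vanishes separately (`curvDiff_eq_zero`, `extCovDiff_eq_zero`).

After complexification, anticommutation says that `a_v` exchanges `T^{1,0}` and `T^{0,1}`. With
symmetry, `a_v w` for `v`, `w` of opposite types lies in both subspaces and is zero
(`diffForm_T10_T01`). Hence `A` sends `T^{1,0}` to `T^{0,1}` and kills `T^{0,1}`, `A ∧ A = 0`, and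
`a ∧ a = A ∧ Ā + Ā ∧ A`. The tensor `D a` is symmetric in its first two slots because `d_D a = 0`,
and in its last two because `a` is symmetric. As `D` preserves types, `D a` vanishes on arguments of
mixed type (`covForm_mixed`). The four equations for `A` and `Ā`, and the holomorphy of `A`, are the
components of these two facts. Finally `R_D = -a ∧ a` has no `(0,2)`-part, so `D^{0,1}` squares to
zero. -/

theorem cplxStr_cplxStr (x : M) (v : TangentSpace 𝓘(ℝ, E) x) :
    cplxStr E x (cplxStr E x v) = -v := by
  change Complex.I • Complex.I • (show E from v) = -(show E from v)
  rw [smul_smul, Complex.I_mul_I, neg_one_smul]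

theorem applyI_applyI (X : VF E M) : applyI (applyI X) = -X :=
  funext fun x => cplxStr_cplxStr x (X x)

theorem applyI_add (X Y : VF E M) : applyI (X + Y) = applyI X + applyI Y :=
  funext fun x => map_add (cplxStr E x) (X x) (Y x)

theorem applyI_sub (X Y : VF E M) : applyI (X - Y) = applyI X - applyI Y :=
  funext fun x => map_sub (cplxStr E x) (X x) (Y x)

theorem applyI_neg (X : VF E M) : applyI (-X) = -applyI X :=
  funext fun x => map_neg (cplxStr E x) (X x)

theorem applyI_smul (c : ℝ) (X : VF E M) : applyI (c • X) = c • applyI X :=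
  funext fun x => map_smul (cplxStr E x) c (X x)

variable [IsManifold 𝓘(ℂ, E) ω M]

theorem SmoothVF.mdifferentiableAt {X : VF E M} (hX : SmoothVF X) (x : M) :
    MDifferentiableAt 𝓘(ℝ, E) 𝓘(ℝ, E).tangent
      (fun y => (⟨y, X y⟩ : Bundle.TotalSpace E (TangentSpace 𝓘(ℝ, E) : M → Type _))) x :=
  (hX x).mdifferentiableAt (by simp)

theorem SmoothVF.add {X Y : VF E M} (hX : SmoothVF X) (hY : SmoothVF Y) : SmoothVF (X + Y) :=
  ContMDiff.add_section hX hY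

theorem SmoothVF.sub {X Y : VF E M} (hX : SmoothVF X) (hY : SmoothVF Y) : SmoothVF (X - Y) :=
  ContMDiff.sub_section hX hY

theorem SmoothVF.neg {X : VF E M} (hX : SmoothVF X) : SmoothVF (-X) :=
  ContMDiff.neg_section hX

theorem SmoothVF.smul {f : M → ℝ} {X : VF E M} (hf : ContMDiff 𝓘(ℝ, E) 𝓘(ℝ, ℝ) ∞ f)
    (hX : SmoothVF X) : SmoothVF (f • X) :=
  ContMDiff.smul_section hf hX

theorem smoothVF_zero : SmoothVF (0 : VF E M) :=
  Bundle.contMDiff_zeroSection ℝ (TangentSpace 𝓘(ℝ, E) : M → Type _)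

/-- Coordinate changes of the real tangent bundle are complex linear. -/
theorem tangentCoordChange_smul_I (x y z : M)
    (hz : z ∈ (extChartAt 𝓘(ℝ, E) x).source ∩ (extChartAt 𝓘(ℝ, E) y).source) (v : E) :
    tangentCoordChange 𝓘(ℝ, E) x y z (Complex.I • v) =
      Complex.I • tangentCoordChange 𝓘(ℝ, E) x y z v := by
  have hR := hasFDerivWithinAt_tangentCoordChange (I := 𝓘(ℝ, E)) hz
  have hC := (hasFDerivWithinAt_tangentCoordChange (I := 𝓘(ℂ, E)) (x := x) (y := y) (z := z)
    (by simpa using hz)).restrictScalars ℝ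
  have hR' : HasFDerivWithinAt ((extChartAt 𝓘(ℝ, E) y) ∘ (extChartAt 𝓘(ℝ, E) x).symm)
    (tangentCoordChange 𝓘(ℝ, E) x y z) Set.univ (extChartAt 𝓘(ℝ, E) x z) := by simpa using hR
  have hC' : HasFDerivWithinAt ((extChartAt 𝓘(ℝ, E) y) ∘ (extChartAt 𝓘(ℝ, E) x).symm)
    ((tangentCoordChange 𝓘(ℂ, E) x y z).restrictScalars ℝ) Set.univ
      (extChartAt 𝓘(ℝ, E) x z) := by simpa using hC
  -- The real derivative of the transition map is the restriction of its complex derivative, by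
  -- uniqueness of derivatives.
  rw [uniqueDiffWithinAt_univ.eq hR' hC']
  simp

/-- The operator `I` is defined at each point in that point's own chart. Complex linearity of the
coordinate changes makes it multiplication by `i` in one fixed trivialization near `x₀`, where
smoothness is visible. -/
theorem SmoothVF.applyI {X : VF E M} (hX : SmoothVF X) : SmoothVF (applyI X) := by
  intro x₀
  have h := (Bundle.contMDiffAt_section x₀).1 (hX x₀)
  refine (Bundle.contMDiffAt_section x₀).2 ?_
  have h2 : ContMDiffAt 𝓘(ℝ, E) 𝓘(ℝ, E) ∞
      (fun x => Complex.I • (trivializationAt E (TangentSpace 𝓘(ℝ, E)) x₀ ⟨x, X x⟩).2) x₀ :=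
    ((Complex.I • ContinuousLinearMap.id ℝ E).contMDiff.contMDiffAt).comp x₀ h
  refine h2.congr_of_eventuallyEq ?_
  filter_upwards [(isOpen_extChartAt_source (I := 𝓘(ℝ, E)) x₀).mem_nhds
    (mem_extChartAt_source (I := 𝓘(ℝ, E)) x₀)] with x hx
  exact tangentCoordChange_smul_I x x₀ x ⟨mem_extChartAt_source (I := 𝓘(ℝ, E)) x, hx⟩ (X x)

/-- This carries tensor identities proved for smooth fields over to individual tangent vectors. A
local extension is cut off by a bump function, which is where the Hausdorff property enters. -/
theorem exists_smoothVF [FiniteDimensional ℂ E] [T2Space M] (x : M)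
    (v : TangentSpace 𝓘(ℝ, E) x) : ∃ X : VF E M, SmoothVF X ∧ X x = v := by
  have : FiniteDimensional ℝ E := FiniteDimensional.complexToReal E
  obtain ⟨u, hu, hs⟩ := FiberBundle.exists_contMDiffOn_extend 𝓘(ℝ, E) E (k := ∞) v
  obtain ⟨f, -, hf⟩ := (SmoothBumpFunction.nhds_basis_tsupport (I := 𝓘(ℝ, E)) x).mem_iff.1
    (interior_mem_nhds.2 hu)
  refine ⟨(f : M → ℝ) • FiberBundle.extend E v, ?_, by simp⟩
  exact ContMDiffOn.smul_section_of_tsupport f.contMDiff.contMDiffOn isOpen_interior hf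
    (hs.mono interior_subset)

end

section

variable {E : Type*} [NormedAddCommGroup E] [NormedSpace ℂ E]
  {M : Type*} [TopologicalSpace M] [ChartedSpace E M] [IsManifold 𝓘(ℂ, E) ω M]
  {D : Conn E M}

/-! ### Real connections -/

theorem along_add (D : Conn E M) (X : VF E M) {Y Y' : VF E M} (hY : SmoothVF Y)
    (hY' : SmoothVF Y') : along D X (Y + Y') = along D X Y + along D X Y' := by
  funext x
  have h := D.isCovariantDerivativeOnUniv.add (hY.mdifferentiableAt x) (hY'.mdifferentiableAt x)
  exact congrArg (fun L => L (X x)) h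

theorem along_smul (D : Conn E M) (X : VF E M) (c : ℝ) {Y : VF E M} (hY : SmoothVF Y) :
    along D X (c • Y) = c • along D X Y := by
  funext x
  have h := D.isCovariantDerivativeOnUniv.smul_const c (hY.mdifferentiableAt x)
  exact congrArg (fun L => L (X x)) h

theorem along_neg (D : Conn E M) (X : VF E M) {Y : VF E M} (hY : SmoothVF Y) :
    along D X (-Y) = -along D X Y := by
  simpa using along_smul D X (-1) hY

theorem along_sub (D : Conn E M) (X : VF E M) {Y Y' : VF E M} (hY : SmoothVF Y)
    (hY' : SmoothVF Y') : along D X (Y - Y') = along D X Y - along D X Y' := by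
  rw [sub_eq_add_neg, along_add D X hY hY'.neg, along_neg D X hY', sub_eq_add_neg]

theorem along_fun_smul (D : Conn E M) (X : VF E M) {f : M → ℝ} {Y : VF E M}
    (hf : ContMDiff 𝓘(ℝ, E) 𝓘(ℝ, ℝ) ∞ f) (hY : SmoothVF Y) :
    along D X (f • Y) = f • along D X Y + dirDeriv X f • Y := by
  funext x
  have h := D.isCovariantDerivativeOnUniv.leibniz (hY.mdifferentiableAt x)
    ((hf x).mdifferentiableAt (by simp))
  exact congrArg (fun L => L (X x)) h

theorem SmoothVF.along (hD : CovariantDerivative.ContMDiffCovariantDerivative D ∞)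
    {X Y : VF E M} (hX : SmoothVF X) (hY : SmoothVF Y) : SmoothVF (along D X Y) := by
  have h := hD.contMDiff.contMDiff (σ := Y) (by simpa using hY.contMDiffOn)
  rw [contMDiffOn_univ] at h
  exact ContMDiff.clm_bundle_apply h hX

variable [FiniteDimensional ℂ E]

theorem IsTorsionFree.along_sub_along (hD : IsTorsionFree D) {X Y : VF E M} (hX : SmoothVF X)
    (hY : SmoothVF Y) : SpecialKahler.along D X Y - SpecialKahler.along D Y X = bracket X Y := by
  have : CompleteSpace E := FiniteDimensional.complete ℂ E
  funext x
  exact (CovariantDerivative.torsion_eq_zero_iff D).1 hD (hX.mdifferentiableAt x)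
    (hY.mdifferentiableAt x)

/-- The vector field `a(X, Y)` for the 1-form `a = nabla - D` with values in `End(TM)`. -/
def diffAct (nabla D : Conn E M) (X Y : VF E M) : VF E M :=
  fun x => nabla.difference D x (Y x) (X x)

theorem diffAct_eq (nabla D : Conn E M) (X : VF E M) {Y : VF E M} (hY : SmoothVF Y) :
    diffAct nabla D X Y = along nabla X Y - along D X Y := by
  funext x
  have h := nabla.isCovariantDerivativeOnUniv.difference_apply D.isCovariantDerivativeOnUniv
    (hσ := hY.mdifferentiableAt x)
  exact congrArg (fun L => L (X x)) h

end

section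

variable {E : Type*} [NormedAddCommGroup E] [NormedSpace ℂ E]
  {M : Type*} [TopologicalSpace M] [ChartedSpace E M] [IsManifold 𝓘(ℂ, E) ω M]
  {Ω : BilinField E M} {nabla D : Conn E M}

/-! ### Kähler forms -/

theorem IsKahlerForm.apply_applyI_right (hΩ : IsKahlerForm Ω) (x : M)
    (v w : TangentSpace 𝓘(ℝ, E) x) : Ω x v (cplxStr E x w) = -Ω x (cplxStr E x v) w := by
  rw [← hΩ.invariant x v, cplxStr_cplxStr, map_neg]

theorem IsKahlerForm.skew (hΩ : IsKahlerForm Ω) (x : M)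
    (v w : TangentSpace 𝓘(ℝ, E) x) : Ω x v w = -Ω x w v := by
  have h := hΩ.alt x (v + w)
  simp only [map_add, LinearMap.add_apply, hΩ.alt] at h
  linarith

theorem IsKahlerForm.kahlerMetric_symm (hΩ : IsKahlerForm Ω) (x : M)
    (v w : TangentSpace 𝓘(ℝ, E) x) : kahlerMetric Ω x v w = kahlerMetric Ω x w v := by
  change Ω x v (cplxStr E x w) = Ω x w (cplxStr E x v)
  rw [hΩ.apply_applyI_right, hΩ.skew, neg_neg]

theorem IsKahlerForm.eq_zero_of_kahlerMetric (hΩ : IsKahlerForm Ω) (x : M)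
    (v : TangentSpace 𝓘(ℝ, E) x) (h : ∀ w, kahlerMetric Ω x v w = 0) : v = 0 := by
  refine hΩ.nondegenerate x v fun w => ?_
  -- Testing `g` against `-I w` recovers `Ω x v w`.
  have h2 : Ω x v (cplxStr E x (-cplxStr E x w)) = 0 := h _
  rwa [map_neg, cplxStr_cplxStr, neg_neg] at h2

variable [FiniteDimensional ℂ E]

/-! ### The Levi-Civita connection of a special Kähler manifold -/

/-- The average `(nabla_X Y - I nabla_X (I Y)) / 2` of `nabla` and its conjugate by `I`. -/
def complexAverage (nabla : Conn E M) (X Y : VF E M) : VF E M :=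
  (1 / 2 : ℝ) • (along nabla X Y - applyI (along nabla X (applyI Y)))

/-- Half of the bracket comes from torsion freeness of `nabla`. The other half comes from applying
`I` to `d_nabla I = 0`, which turns `I [X, Y]` into `-[X, Y]`. -/
theorem IsSpecialKahler.complexAverage_torsion (hM : IsSpecialKahler Ω nabla) {X Y : VF E M}
    (hX : SmoothVF X) (hY : SmoothVF Y) :
    complexAverage nabla X Y - complexAverage nabla Y X = bracket X Y := by
  have h1 := hM.torsionFree.along_sub_along hX hY
  have h2 := congrArg applyI (hM.extCovI_eq_zero X Y hX hY)
  rw [extCovI, applyI_sub, applyI_sub, applyI_applyI] at h2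
  have h3 : applyI (0 : VF E M) = 0 := funext fun x => map_zero (cplxStr E x)
  rw [h3] at h2
  simp only [complexAverage]
  linear_combination (norm := module) (1 / 2 : ℝ) • h1 - (1 / 2 : ℝ) • h2

/-- The metric has the two expressions `Ω(Y, I Z)` and `Ω(I Y, -Z)`. Differentiating both with
`nabla Ω = 0` and taking the mean produces exactly the averaged connection. -/
theorem IsSpecialKahler.dirDeriv_kahlerMetric (hM : IsSpecialKahler Ω nabla) {X Y Z : VF E M}
    (hX : SmoothVF X) (hY : SmoothVF Y) (hZ : SmoothVF Z) (x : M) :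
    dirDeriv X (fun y => kahlerMetric Ω y (Y y) (Z y)) x =
      kahlerMetric Ω x (complexAverage nabla X Y x) (Z x) +
        kahlerMetric Ω x (Y x) (complexAverage nabla X Z x) := by
  have hΩ := hM.kahler
  have h1 : dirDeriv X (fun y => kahlerMetric Ω y (Y y) (Z y)) x = _ :=
    hM.parallel X Y (applyI Z) hX hY hZ.applyI x
  have e : (fun y => kahlerMetric Ω y (Y y) (Z y)) = fun y => Ω y (applyI Y y) ((-Z) y) :=
    funext fun y => by
      change Ω y (Y y) (cplxStr E y (Z y)) = Ω y (cplxStr E y (Y y)) (-Z y)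
      rw [hΩ.apply_applyI_right, map_neg]
  have h2 := hM.parallel X (applyI Y) (-Z) hX hY.applyI hZ.neg x
  rw [← e, along_neg nabla X hZ] at h2
  have h3 : ∀ u v, kahlerMetric Ω x u v = Ω x u (cplxStr E x v) := fun _ _ => rfl
  have h4 : ∀ W : VF E M, applyI W x = cplxStr E x (W x) := fun _ => rfl
  simp only [h3, complexAverage, Pi.smul_apply, Pi.sub_apply, Pi.neg_apply, map_smul, map_sub,
    LinearMap.smul_apply, LinearMap.sub_apply, smul_eq_mul, h4, cplxStr_cplxStr, map_neg,
    hΩ.invariant] at h1 h2 ⊢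
  rw [hΩ.apply_applyI_right x (Y x) (along nabla X Z x)]
  linarith

/-! ### Decomposition of the flatness of `nabla` -/

theorem SmoothVF.diffAct (hN : CovariantDerivative.ContMDiffCovariantDerivative nabla ∞)
    (hD : CovariantDerivative.ContMDiffCovariantDerivative D ∞)
    {X Y : VF E M} (hX : SmoothVF X) (hY : SmoothVF Y) : SmoothVF (diffAct nabla D X Y) := by
  rw [diffAct_eq nabla D X hY]
  exact (hX.along hN hY).sub (hX.along hD hY)

/-- A smooth torsion-free connection expresses the bracket through covariant derivatives, whose
smoothness is already known. -/
theorem SmoothVF.bracket (hD : IsTorsionFree D)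
    (hs : CovariantDerivative.ContMDiffCovariantDerivative D ∞)
    {X Y : VF E M} (hX : SmoothVF X) (hY : SmoothVF Y) : SmoothVF (bracket X Y) := by
  rw [← hD.along_sub_along hX hY]
  exact (hX.along hs hY).sub (hY.along hs hX)

/-- The exterior covariant derivative `(d_D a)(X, Y) S` of `a = nabla - D`. -/
def extCovDiff (nabla D : Conn E M) (X Y S : VF E M) : VF E M :=
  along D X (diffAct nabla D Y S) - diffAct nabla D Y (along D X S)
    - (along D Y (diffAct nabla D X S) - diffAct nabla D X (along D Y S))
    - diffAct nabla D (bracket X Y) S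

/-- The part `R_D(X, Y) S + [a_X, a_Y] S` of the curvature of `nabla` that commutes
with `I`. -/
def curvDiff (nabla D : Conn E M) (X Y S : VF E M) : VF E M :=
  curv D X Y S + diffAct nabla D X (diffAct nabla D Y S)
    - diffAct nabla D Y (diffAct nabla D X S)

/-- The usual expansion of the curvature of `D + a`, with its terms grouped by the parity of their
degree in `a`, which decides how they commute with `I`. -/
theorem curv_eq (hN : CovariantDerivative.ContMDiffCovariantDerivative nabla ∞)
    (hD : CovariantDerivative.ContMDiffCovariantDerivative D ∞)
    {X Y S : VF E M} (hX : SmoothVF X) (hY : SmoothVF Y) (hS : SmoothVF S) :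
    curv nabla X Y S = curvDiff nabla D X Y S + extCovDiff nabla D X Y S := by
  have h : ∀ {X Y : VF E M}, SmoothVF Y → along nabla X Y = along D X Y + diffAct nabla D X Y := by
    intro X Y hY
    rw [diffAct_eq nabla D X hY, add_sub_cancel]
  have hadd : ∀ {X Y Y' : VF E M}, diffAct nabla D X (Y + Y') =
      diffAct nabla D X Y + diffAct nabla D X Y' := by
    intro X Y Y'
    funext x
    simp [diffAct]
  rw [curv, h (hY.along hN hS), h (hX.along hN hS), h hS, h hS, h hS,
    along_add D X (hY.along hD hS) (hY.diffAct hN hD hS),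
    along_add D Y (hX.along hD hS) (hX.diffAct hN hD hS), hadd, hadd,
    curvDiff, extCovDiff, curv]
  abel

theorem IsSpecialKahler.curvDiff_add_extCovDiff (hM : IsSpecialKahler Ω nabla)
    (hD : IsLeviCivita (kahlerMetric Ω) D) {X Y S : VF E M} (hX : SmoothVF X) (hY : SmoothVF Y)
    (hS : SmoothVF S) : curvDiff nabla D X Y S + extCovDiff nabla D X Y S = 0 := by
  rw [← curv_eq hM.smooth hD.smooth hX hY hS, hM.flat X Y S hX hY hS]

theorem IsSpecialKahler.diffAct_symm (hM : IsSpecialKahler Ω nabla)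
    (hD : IsLeviCivita (kahlerMetric Ω) D) {X Y : VF E M} (hX : SmoothVF X) (hY : SmoothVF Y) :
    diffAct nabla D X Y = diffAct nabla D Y X := by
  have h1 := hM.torsionFree.along_sub_along hX hY
  have h2 := hD.torsionFree.along_sub_along hX hY
  rw [diffAct_eq nabla D X hY, diffAct_eq nabla D Y hX]
  linear_combination (norm := module) h1 - h2

/-! ### Identification of `D` with the average, and splitting of the flatness equation by `I`. -/

variable [T2Space M]

/-- Uniqueness of the Levi-Civita connection: the difference of two torsion-free metric connections,
lowered by `g`, is symmetric in its first two slots and skew in its last two, hence zero. -/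
theorem IsSpecialKahler.along_eq (hM : IsSpecialKahler Ω nabla)
    (hD : IsLeviCivita (kahlerMetric Ω) D) {X Y : VF E M} (hX : SmoothVF X) (hY : SmoothVF Y) :
    along D X Y = complexAverage nabla X Y := by
  have hΩ := hM.kahler
  have hsymm : ∀ X Y : VF E M, SmoothVF X → SmoothVF Y →
      along D X Y - complexAverage nabla X Y = along D Y X - complexAverage nabla Y X := by
    intro X Y hX hY
    have h1 := hD.torsionFree.along_sub_along hX hY
    rw [← hM.complexAverage_torsion hX hY] at h1
    linear_combination (norm := module) h1
  let c (X Y Z : VF E M) (x : M) : ℝ :=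
    kahlerMetric Ω x ((along D X Y - complexAverage nabla X Y) x) (Z x)
  have c12 : ∀ X Y Z : VF E M, SmoothVF X → SmoothVF Y → ∀ x, c X Y Z x = c Y X Z x := by
    intro X Y Z hX hY x
    simp only [c, hsymm X Y hX hY]
  have c23 : ∀ X Y Z : VF E M, SmoothVF X → SmoothVF Y → SmoothVF Z → ∀ x,
      c X Y Z x = -c X Z Y x := by
    intro X Y Z hX hY hZ x
    have h1 := hD.metric X Y Z hX hY hZ x
    rw [hM.dirDeriv_kahlerMetric hX hY hZ] at h1
    simp only [c, Pi.sub_apply, map_sub, LinearMap.sub_apply]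
    rw [hΩ.kahlerMetric_symm x (Y x), hΩ.kahlerMetric_symm x (Y x)] at h1
    linarith
  funext x
  refine sub_eq_zero.1 (hΩ.eq_zero_of_kahlerMetric x _ fun w => ?_)
  obtain ⟨Z, hZ, rfl⟩ := exists_smoothVF x w
  change c X Y Z x = 0
  -- Alternating the two transpositions six times returns to `(X, Y, Z)` with three sign changes, so
  -- `c = -c`.
  have e1 := c23 X Y Z hX hY hZ x
  have e2 := c12 X Z Y hX hZ x
  have e3 := c23 Z X Y hZ hX hY x
  have e4 := c12 Z Y X hZ hY x
  have e5 := c23 Y Z X hY hZ hX x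
  have e6 := c12 Y X Z hY hX x
  linarith

theorem IsSpecialKahler.along_applyI (hM : IsSpecialKahler Ω nabla)
    (hD : IsLeviCivita (kahlerMetric Ω) D) {X Y : VF E M} (hX : SmoothVF X) (hY : SmoothVF Y) :
    along D X (applyI Y) = applyI (along D X Y) := by
  rw [hM.along_eq hD hX hY, hM.along_eq hD hX hY.applyI, complexAverage, complexAverage,
    applyI_smul, applyI_sub, applyI_applyI, applyI_applyI, along_neg nabla X hY, applyI_neg]
  module

/-- Subtracting the average from `nabla` leaves `(nabla + I nabla I) / 2`, the part of `nabla` that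
anticommutes with `I`. -/
theorem IsSpecialKahler.diffAct_applyI (hM : IsSpecialKahler Ω nabla)
    (hD : IsLeviCivita (kahlerMetric Ω) D) {X Y : VF E M} (hX : SmoothVF X) (hY : SmoothVF Y) :
    diffAct nabla D X (applyI Y) = -applyI (diffAct nabla D X Y) := by
  rw [diffAct_eq nabla D X hY, diffAct_eq nabla D X hY.applyI, hM.along_applyI hD hX hY,
    applyI_sub, hM.along_eq hD hX hY, complexAverage, applyI_smul, applyI_sub, applyI_applyI]
  module

theorem IsSpecialKahler.difference_symm (hM : IsSpecialKahler Ω nabla)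
    (hD : IsLeviCivita (kahlerMetric Ω) D) (x : M) (v w : TangentSpace 𝓘(ℝ, E) x) :
    nabla.difference D x w v = nabla.difference D x v w := by
  obtain ⟨X, hX, rfl⟩ := exists_smoothVF x v
  obtain ⟨Y, hY, rfl⟩ := exists_smoothVF x w
  exact congrFun (hM.diffAct_symm hD hX hY) x

theorem IsSpecialKahler.difference_cplxStr (hM : IsSpecialKahler Ω nabla)
    (hD : IsLeviCivita (kahlerMetric Ω) D) (x : M) (v w : TangentSpace 𝓘(ℝ, E) x) :
    nabla.difference D x (cplxStr E x w) v = -cplxStr E x (nabla.difference D x w v) := by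
  obtain ⟨X, hX, rfl⟩ := exists_smoothVF x v
  obtain ⟨Y, hY, rfl⟩ := exists_smoothVF x w
  exact congrFun (hM.diffAct_applyI hD hX hY) x

/-- `D` commutes with `I`, and in the quadratic terms `I` passes two factors `a`, so the signs
cancel. -/
theorem IsSpecialKahler.curvDiff_applyI (hM : IsSpecialKahler Ω nabla)
    (hD : IsLeviCivita (kahlerMetric Ω) D) {X Y S : VF E M} (hX : SmoothVF X) (hY : SmoothVF Y)
    (hS : SmoothVF S) : curvDiff nabla D X Y (applyI S) = applyI (curvDiff nabla D X Y S) := by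
  have hXY := hX.bracket hD.torsionFree hD.smooth hY
  have hneg : ∀ {X Y : VF E M}, diffAct nabla D X (-Y) = -diffAct nabla D X Y := by
    intro X Y
    funext x
    simp [diffAct]
  have hYS := hY.diffAct hM.smooth hD.smooth hS
  have hXS := hX.diffAct hM.smooth hD.smooth hS
  simp only [curvDiff, curv, applyI_add, applyI_sub]
  rw [hM.along_applyI hD hX hS, hM.along_applyI hD hY hS, hM.along_applyI hD hXY hS,
    hM.along_applyI hD hX (hY.along hD.smooth hS), hM.along_applyI hD hY (hX.along hD.smooth hS),
    hM.diffAct_applyI hD hX hS, hM.diffAct_applyI hD hY hS, hneg, hneg,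
    hM.diffAct_applyI hD hX hYS, hM.diffAct_applyI hD hY hXS, neg_neg, neg_neg]

/-- Every term contains `a` exactly once, so moving `I` to the front costs one sign. -/
theorem IsSpecialKahler.extCovDiff_applyI (hM : IsSpecialKahler Ω nabla)
    (hD : IsLeviCivita (kahlerMetric Ω) D) {X Y S : VF E M} (hX : SmoothVF X) (hY : SmoothVF Y)
    (hS : SmoothVF S) :
    extCovDiff nabla D X Y (applyI S) = -applyI (extCovDiff nabla D X Y S) := by
  have hXY := hX.bracket hD.torsionFree hD.smooth hY
  have hYS := hY.diffAct hM.smooth hD.smooth hS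
  have hXS := hX.diffAct hM.smooth hD.smooth hS
  simp only [extCovDiff, applyI_sub]
  rw [hM.along_applyI hD hX hS, hM.along_applyI hD hY hS,
    hM.diffAct_applyI hD hX hS, hM.diffAct_applyI hD hY hS, hM.diffAct_applyI hD hXY hS,
    hM.diffAct_applyI hD hX (hY.along hD.smooth hS),
    hM.diffAct_applyI hD hY (hX.along hD.smooth hS),
    along_neg D X hYS.applyI, along_neg D Y hXS.applyI,
    hM.along_applyI hD hX hYS, hM.along_applyI hD hY hXS]
  abel

/-- The flatness equation is evaluated at `I S` and `I` is then cancelled; only the sign of the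
anticommuting part changes. -/
theorem IsSpecialKahler.curvDiff_sub_extCovDiff (hM : IsSpecialKahler Ω nabla)
    (hD : IsLeviCivita (kahlerMetric Ω) D) {X Y S : VF E M} (hX : SmoothVF X) (hY : SmoothVF Y)
    (hS : SmoothVF S) : curvDiff nabla D X Y S - extCovDiff nabla D X Y S = 0 := by
  have h := hM.curvDiff_add_extCovDiff hD hX hY hS.applyI
  rw [hM.curvDiff_applyI hD hX hY hS, hM.extCovDiff_applyI hD hX hY hS, ← sub_eq_add_neg,
    ← applyI_sub] at h
  have h2 := congrArg applyI h
  have h3 : applyI (0 : VF E M) = 0 := funext fun x => map_zero (cplxStr E x)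
  rwa [applyI_applyI, h3, neg_eq_zero] at h2

theorem IsSpecialKahler.curvDiff_eq_zero (hM : IsSpecialKahler Ω nabla)
    (hD : IsLeviCivita (kahlerMetric Ω) D) {X Y S : VF E M} (hX : SmoothVF X) (hY : SmoothVF Y)
    (hS : SmoothVF S) : curvDiff nabla D X Y S = 0 := by
  have h1 := hM.curvDiff_add_extCovDiff hD hX hY hS
  have h2 := hM.curvDiff_sub_extCovDiff hD hX hY hS
  linear_combination (norm := module) (1 / 2 : ℝ) • h1 + (1 / 2 : ℝ) • h2

theorem IsSpecialKahler.extCovDiff_eq_zero (hM : IsSpecialKahler Ω nabla)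
    (hD : IsLeviCivita (kahlerMetric Ω) D) {X Y S : VF E M} (hX : SmoothVF X) (hY : SmoothVF Y)
    (hS : SmoothVF S) : extCovDiff nabla D X Y S = 0 := by
  have h1 := hM.curvDiff_add_extCovDiff hD hX hY hS
  rwa [hM.curvDiff_eq_zero hD hX hY hS, zero_add] at h1

end

section

variable {E : Type*} [NormedAddCommGroup E] [NormedSpace ℂ E]
  {M : Type*} [TopologicalSpace M] [ChartedSpace E M]

/-! ### Complex tangent vectors -/

@[simp]
theorem re_tmul (x : M) (c : ℂ) (v : TangentSpace 𝓘(ℝ, E) x) :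
    re E x (c ⊗ₜ[ℝ] v) = c.re • v := by
  simp [re]

@[simp]
theorem im_tmul (x : M) (c : ℂ) (v : TangentSpace 𝓘(ℝ, E) x) :
    im E x (c ⊗ₜ[ℝ] v) = c.im • v := by
  simp [im]

theorem tmul_re_add_tmul_im (x : M) (v : TC E x) :
    (1 : ℂ) ⊗ₜ[ℝ] re E x v + Complex.I • (1 : ℂ) ⊗ₜ[ℝ] im E x v = v := by
  induction v using TensorProduct.induction_on with
  | zero => simp
  | tmul c v =>
    rw [re_tmul, im_tmul, TensorProduct.smul_tmul', ← TensorProduct.smul_tmul,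
      ← TensorProduct.smul_tmul, ← TensorProduct.add_tmul]
    congr 1
    apply Complex.ext <;> simp
  | add v w hv hw =>
    rw [map_add, map_add, TensorProduct.tmul_add, TensorProduct.tmul_add, smul_add]
    nth_rewrite 3 [← hv]
    nth_rewrite 3 [← hw]
    abel

theorem re_smul (x : M) (c : ℂ) (v : TC E x) :
    re E x (c • v) = c.re • re E x v - c.im • im E x v := by
  induction v using TensorProduct.induction_on with
  | zero => simp
  | tmul d v => simp [TensorProduct.smul_tmul', mul_smul, sub_smul]
  | add v w hv hw =>
    rw [smul_add, map_add, hv, hw, map_add, map_add]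
    module

theorem im_smul (x : M) (c : ℂ) (v : TC E x) :
    im E x (c • v) = c.re • im E x v + c.im • re E x v := by
  induction v using TensorProduct.induction_on with
  | zero => simp
  | tmul d v => simp [TensorProduct.smul_tmul', mul_smul, add_smul]
  | add v w hv hw =>
    rw [smul_add, map_add, hv, hw, map_add, map_add]
    module

/-- Real vectors span `T_x^ℂ M` over `ℂ`, so complex linear or conjugate linear identities need only
be checked on them. -/
theorem TC_induction {x : M} {P : TC E x → Prop} (h : ∀ u, P ((1 : ℂ) ⊗ₜ[ℝ] u))
    (hadd : ∀ v w, P v → P w → P (v + w)) (hsmul : ∀ (c : ℂ) v, P v → P (c • v))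
    (v : TC E x) : P v := by
  rw [← tmul_re_add_tmul_im x v]
  exact hadd _ _ (h _) (hsmul _ _ (h _))

/-- The complex linear extension of the complex structure. -/
abbrev IC (x : M) : TC E x →ₗ[ℂ] TC E x := (cplxStr E x).baseChange ℂ

theorem IC_IC (x : M) (v : TC E x) : IC x (IC x v) = -v := by
  induction v using TC_induction with
  | h u => simp [cplxStr_cplxStr, TensorProduct.tmul_neg]
  | hadd v w hv hw => rw [map_add, map_add, hv, hw]; abel
  | hsmul c v hv => rw [map_smul, map_smul, hv, smul_neg]

theorem mem_T10 {x : M} {v : TC E x} : v ∈ T10 E x ↔ IC x v = Complex.I • v := by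
  simp [T10, sub_eq_zero]

theorem mem_T01 {x : M} {v : TC E x} : v ∈ T01 E x ↔ IC x v = -(Complex.I • v) := by
  simp [T01, add_eq_zero_iff_eq_neg]

theorem pi10_apply (x : M) (v : TC E x) :
    pi10 E x v = (1 / 2 : ℂ) • (v - Complex.I • IC x v) := rfl

theorem pi01_apply (x : M) (v : TC E x) :
    pi01 E x v = (1 / 2 : ℂ) • (v + Complex.I • IC x v) := rfl

theorem pi10_add_pi01 (x : M) (v : TC E x) : pi10 E x v + pi01 E x v = v := by
  rw [pi10_apply, pi01_apply]
  module

theorem pi10_mem (x : M) (v : TC E x) : pi10 E x v ∈ T10 E x := by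
  rw [mem_T10, pi10_apply, map_smul, map_sub, map_smul, IC_IC]
  linear_combination (norm := module) ((1 / 2 : ℂ) * Complex.I_mul_I) • IC x v

theorem pi01_mem (x : M) (v : TC E x) : pi01 E x v ∈ T01 E x := by
  rw [mem_T01, pi01_apply, map_smul, map_add, map_smul, IC_IC]
  linear_combination (norm := module) ((1 / 2 : ℂ) * Complex.I_mul_I) • IC x v

theorem pi10_of_mem {x : M} {v : TC E x} (h : v ∈ T10 E x) : pi10 E x v = v := by
  rw [pi10_apply, mem_T10.1 h, smul_smul, Complex.I_mul_I]
  module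

theorem pi01_of_mem {x : M} {v : TC E x} (h : v ∈ T01 E x) : pi01 E x v = v := by
  rw [pi01_apply, mem_T01.1 h, smul_neg, smul_smul, Complex.I_mul_I]
  module

theorem pi10_of_mem_T01 {x : M} {v : TC E x} (h : v ∈ T01 E x) : pi10 E x v = 0 := by
  rw [pi10_apply, mem_T01.1 h, smul_neg, smul_smul, Complex.I_mul_I]
  module

theorem pi01_of_mem_T10 {x : M} {v : TC E x} (h : v ∈ T10 E x) : pi01 E x v = 0 := by
  rw [pi01_apply, mem_T10.1 h, smul_smul, Complex.I_mul_I]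
  module

theorem conjTC_IC (x : M) (v : TC E x) : IC x (conjTC E x v) = conjTC E x (IC x v) := by
  induction v using TC_induction with
  | h u => simp [conjTC]
  | hadd v w hv hw => simp only [map_add, hv, hw]
  | hsmul c v hv => rw [conjTC_smul, map_smul, map_smul, conjTC_smul, hv]

/-- `I` is a real operator, so conjugation swaps its `i` and `-i` eigenspaces. -/
theorem pi10_conjTC (x : M) (v : TC E x) : pi10 E x (conjTC E x v) = conjTC E x (pi01 E x v) := by
  rw [pi10_apply, pi01_apply, conjTC_smul, map_add, conjTC_smul, conjTC_IC]
  simp [sub_eq_add_neg, Complex.conj_ofNat]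

/-! ### Complex vector fields -/

/-- A real vector field, seen as a section of `T^ℂ M`. -/
def ofReal (X : VF E M) : CVF E M := fun x => (1 : ℂ) ⊗ₜ[ℝ] X x

/-- The real part of a complex vector field. -/
def rePart (Z : CVF E M) : VF E M := fun x => re E x (Z x)

/-- The imaginary part of a complex vector field. -/
def imPart (Z : CVF E M) : VF E M := fun x => im E x (Z x)

theorem ofReal_add (X Y : VF E M) : ofReal (X + Y) = ofReal X + ofReal Y :=
  funext fun x => TensorProduct.tmul_add _ (X x) (Y x)

theorem ofReal_sub (X Y : VF E M) : ofReal (X - Y) = ofReal X - ofReal Y :=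
  funext fun x => TensorProduct.tmul_sub _ (X x) (Y x)

theorem ofReal_zero : ofReal (0 : VF E M) = 0 :=
  funext fun _ => TensorProduct.tmul_zero _ _

theorem ofReal_rePart_add (Z : CVF E M) :
    ofReal (rePart Z) + Complex.I • ofReal (imPart Z) = Z :=
  funext fun x => tmul_re_add_tmul_im x (Z x)

theorem rePart_ofReal (X : VF E M) : rePart (ofReal X) = X :=
  funext fun x => by simp [rePart, ofReal]

theorem imPart_ofReal (X : VF E M) : imPart (ofReal X) = 0 :=
  funext fun x => by simp [imPart, ofReal]

theorem rePart_add (Z W : CVF E M) : rePart (Z + W) = rePart Z + rePart W :=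
  funext fun x => map_add (re E x) (Z x) (W x)

theorem imPart_add (Z W : CVF E M) : imPart (Z + W) = imPart Z + imPart W :=
  funext fun x => map_add (im E x) (Z x) (W x)

theorem rePart_fun_smul (f : M → ℂ) (Z : CVF E M) : rePart (fun x => f x • Z x) =
    (fun x => (f x).re) • rePart Z - (fun x => (f x).im) • imPart Z :=
  funext fun x => re_smul x (f x) (Z x)

theorem imPart_fun_smul (f : M → ℂ) (Z : CVF E M) : imPart (fun x => f x • Z x) =
    (fun x => (f x).re) • imPart Z + (fun x => (f x).im) • rePart Z :=
  funext fun x => im_smul x (f x) (Z x)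

theorem contMDiff_re {f : M → ℂ} (hf : ContMDiff 𝓘(ℝ, E) 𝓘(ℝ, ℂ) ∞ f) :
    ContMDiff 𝓘(ℝ, E) 𝓘(ℝ, ℝ) ∞ (fun x => (f x).re) :=
  Complex.reCLM.contMDiff.comp hf

theorem contMDiff_im {f : M → ℂ} (hf : ContMDiff 𝓘(ℝ, E) 𝓘(ℝ, ℂ) ∞ f) :
    ContMDiff 𝓘(ℝ, E) 𝓘(ℝ, ℝ) ∞ (fun x => (f x).im) :=
  Complex.imCLM.contMDiff.comp hf

theorem mvfderiv_re_im {f : M → ℂ} (hf : ContMDiff 𝓘(ℝ, E) 𝓘(ℝ, ℂ) ∞ f) (x : M)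
    (u : TangentSpace 𝓘(ℝ, E) x) :
    mvfderiv 𝓘(ℝ, E) (fun y => (f y).re) x u = (mvfderiv 𝓘(ℝ, E) f x u).re ∧
      mvfderiv 𝓘(ℝ, E) (fun y => (f y).im) x u = (mvfderiv 𝓘(ℝ, E) f x u).im := by
  have h := ((hf x).mdifferentiableAt (by simp)).hasMFDerivAt
  have h1 := (Complex.reCLM.hasMFDerivAt (x := f x)).comp x h
  have h2 := (Complex.imCLM.hasMFDerivAt (x := f x)).comp x h
  exact ⟨congrArg (fun L => L u) h1.mfderiv, congrArg (fun L => L u) h2.mfderiv⟩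

variable [IsManifold 𝓘(ℂ, E) ω M]

theorem SmoothCVF.rePart {Z : CVF E M} (hZ : SmoothCVF Z) : SmoothVF (rePart Z) := hZ.1

theorem SmoothCVF.imPart {Z : CVF E M} (hZ : SmoothCVF Z) : SmoothVF (imPart Z) := hZ.2

theorem SmoothCVF.mk {Z : CVF E M} (h : SmoothVF (SpecialKahler.rePart Z))
    (h' : SmoothVF (SpecialKahler.imPart Z)) : SmoothCVF Z := ⟨h, h'⟩

theorem SmoothVF.ofReal {X : VF E M} (hX : SmoothVF X) : SmoothCVF (ofReal X) :=
  SmoothCVF.mk (by rwa [rePart_ofReal]) (by rw [imPart_ofReal]; exact smoothVF_zero)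

theorem SmoothCVF.add {Z W : CVF E M} (hZ : SmoothCVF Z) (hW : SmoothCVF W) :
    SmoothCVF (Z + W) :=
  SmoothCVF.mk (by rw [rePart_add]; exact hZ.1.add hW.1) (by rw [imPart_add]; exact hZ.2.add hW.2)

theorem SmoothCVF.fun_smul {f : M → ℂ} {Z : CVF E M}
    (hf : ContMDiff 𝓘(ℝ, E) 𝓘(ℝ, ℂ) ∞ f) (hZ : SmoothCVF Z) : SmoothCVF (fun x => f x • Z x) :=
  SmoothCVF.mk
    (by
      rw [rePart_fun_smul]
      exact (SmoothVF.smul (contMDiff_re hf) hZ.1).sub (SmoothVF.smul (contMDiff_im hf) hZ.2))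
    (by
      rw [imPart_fun_smul]
      exact (SmoothVF.smul (contMDiff_re hf) hZ.2).add (SmoothVF.smul (contMDiff_im hf) hZ.1))

theorem SmoothCVF.smul (c : ℂ) {Z : CVF E M} (hZ : SmoothCVF Z) : SmoothCVF (c • Z) :=
  SmoothCVF.fun_smul (f := fun _ => c) contMDiff_const hZ

/-- A form that is complex trilinear on smooth fields. -/
structure EndForm2.IsTrilinear (F : EndForm2 E M) : Prop where
  add₁ : ∀ {Z Z' W S}, SmoothCVF Z → SmoothCVF Z' → SmoothCVF W → SmoothCVF S →
    F (Z + Z') W S = F Z W S + F Z' W S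
  smul₁ : ∀ (c : ℂ) {Z W S}, SmoothCVF Z → SmoothCVF W → SmoothCVF S →
    F (c • Z) W S = c • F Z W S
  add₂ : ∀ {Z W W' S}, SmoothCVF Z → SmoothCVF W → SmoothCVF W' → SmoothCVF S →
    F Z (W + W') S = F Z W S + F Z W' S
  smul₂ : ∀ (c : ℂ) {Z W S}, SmoothCVF Z → SmoothCVF W → SmoothCVF S →
    F Z (c • W) S = c • F Z W S
  add₃ : ∀ {Z W S S'}, SmoothCVF Z → SmoothCVF W → SmoothCVF S → SmoothCVF S' →
    F Z W (S + S') = F Z W S + F Z W S'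
  smul₃ : ∀ (c : ℂ) {Z W S}, SmoothCVF Z → SmoothCVF W → SmoothCVF S →
    F Z W (c • S) = c • F Z W S

/-- A complex trilinear form that vanishes on real vector fields is zero. -/
theorem EndForm2.IsTrilinear.vanishes {F : EndForm2 E M} (hF : F.IsTrilinear)
    (h : ∀ X Y S : VF E M, SmoothVF X → SmoothVF Y → SmoothVF S →
      F (ofReal X) (ofReal Y) (ofReal S) = 0) : F.Vanishes := by
  have h3 : ∀ X Y : VF E M, SmoothVF X → SmoothVF Y → ∀ S, SmoothCVF S →
      F (ofReal X) (ofReal Y) S = 0 := by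
    intro X Y hX hY S hS
    rw [← ofReal_rePart_add S, hF.add₃ hX.ofReal hY.ofReal hS.rePart.ofReal (hS.imPart.ofReal.smul _),
      hF.smul₃ _ hX.ofReal hY.ofReal hS.imPart.ofReal, h X Y _ hX hY hS.rePart,
      h X Y _ hX hY hS.imPart, smul_zero, add_zero]
  have h2 : ∀ X : VF E M, SmoothVF X → ∀ W S, SmoothCVF W → SmoothCVF S →
      F (ofReal X) W S = 0 := by
    intro X hX W S hW hS
    rw [← ofReal_rePart_add W, hF.add₂ hX.ofReal hW.rePart.ofReal (hW.imPart.ofReal.smul _) hS,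
      hF.smul₂ _ hX.ofReal hW.imPart.ofReal hS, h3 X _ hX hW.rePart S hS,
      h3 X _ hX hW.imPart S hS, smul_zero, add_zero]
  intro Z W S hZ hW hS
  rw [← ofReal_rePart_add Z, hF.add₁ hZ.rePart.ofReal (hZ.imPart.ofReal.smul _) hW hS,
    hF.smul₁ _ hZ.imPart.ofReal hW hS, h2 _ hZ.rePart W S hW hS,
    h2 _ hZ.imPart W S hW hS, smul_zero, add_zero]

/-! ### Complex linear extension of a connection -/

variable {D : Conn E M}

theorem covC_tmul (D : Conn E M) (S : CVF E M) (x : M) (u : TangentSpace 𝓘(ℝ, E) x) :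
    covC D S x ((1 : ℂ) ⊗ₜ[ℝ] u) =
      (1 : ℂ) ⊗ₜ[ℝ] D (rePart S) x u + Complex.I • (1 : ℂ) ⊗ₜ[ℝ] D (imPart S) x u := rfl

theorem covC_add (D : Conn E M) {S S' : CVF E M} (hS : SmoothCVF S) (hS' : SmoothCVF S') (x : M) :
    covC D (S + S') x = covC D S x + covC D S' x := by
  have h1 := D.isCovariantDerivativeOnUniv.add (hS.rePart.mdifferentiableAt x)
    (hS'.rePart.mdifferentiableAt x)
  have h2 := D.isCovariantDerivativeOnUniv.add (hS.imPart.mdifferentiableAt x)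
    (hS'.imPart.mdifferentiableAt x)
  refine LinearMap.ext fun v => ?_
  induction v using TC_induction with
  | h u =>
    rw [LinearMap.add_apply, covC_tmul, covC_tmul, covC_tmul, rePart_add, imPart_add, h1, h2]
    simp only [add_apply, TensorProduct.tmul_add, smul_add]
    abel
  | hadd v w hv hw => rw [map_add, map_add, hv, hw]
  | hsmul c v hv => rw [map_smul, map_smul, hv]

/-- The complex Leibniz rule is assembled from the real one for the real and imaginary parts of `f`
and `S`. -/
theorem covC_fun_smul (D : Conn E M) {f : M → ℂ} {S : CVF E M}
    (hf : ContMDiff 𝓘(ℝ, E) 𝓘(ℝ, ℂ) ∞ f) (hS : SmoothCVF S) (x : M) (v : TC E x) :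
    covC D (fun y => f y • S y) x v = dC f x v • S x + f x • covC D S x v := by
  have key : ∀ u, covC D (fun y => f y • S y) x ((1 : ℂ) ⊗ₜ[ℝ] u) =
      mvfderiv 𝓘(ℝ, E) f x u • S x + f x • covC D S x ((1 : ℂ) ⊗ₜ[ℝ] u) := by
    intro u
    -- Only the value at `x` of the differentiating field matters, so an arbitrary, possibly
    -- discontinuous field suffices.
    obtain ⟨X, rfl⟩ : ∃ X : VF E M, X x = u := by
      classical exact ⟨Function.update 0 x u, by simp⟩
    have hr := contMDiff_re hf
    have hi := contMDiff_im hf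
    have h1 := congrFun (along_sub D X (hS.rePart.smul hr) (hS.imPart.smul hi)) x
    have h2 := congrFun (along_add D X (hS.imPart.smul hr) (hS.rePart.smul hi)) x
    rw [along_fun_smul D X hr hS.rePart, along_fun_smul D X hi hS.imPart,
      ← rePart_fun_smul] at h1
    rw [along_fun_smul D X hr hS.imPart, along_fun_smul D X hi hS.rePart,
      ← imPart_fun_smul] at h2
    simp only [along, Pi.add_apply, Pi.sub_apply, Pi.smul_apply', dirDeriv,
      (mvfderiv_re_im hf x (X x)).1, (mvfderiv_re_im hf x (X x)).2] at h1 h2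
    rw [covC_tmul, covC_tmul, h1, h2]
    conv_rhs => rw [← tmul_re_add_tmul_im x (S x)]
    have hc : ∀ c : ℂ, c = c.re + c.im * Complex.I := fun c => (Complex.re_add_im c).symm
    have ht : ∀ (r : ℝ) (w : TangentSpace 𝓘(ℝ, E) x),
        (1 : ℂ) ⊗ₜ[ℝ] (r • w) = (r : ℂ) • (1 : ℂ) ⊗ₜ[ℝ] w := by
      intro r w
      rw [TensorProduct.tmul_smul]
      rfl
    have hf0 := hc (f x)
    have hf1 := hc (mvfderiv 𝓘(ℝ, E) f x (X x))
    have hI := Complex.I_mul_I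
    change _ = _ • ((1 : ℂ) ⊗ₜ[ℝ] rePart S x + Complex.I • (1 : ℂ) ⊗ₜ[ℝ] imPart S x) + _
    simp only [TensorProduct.tmul_add, TensorProduct.tmul_sub, ht]
    -- What remains is module algebra over `ℂ`, using `i² = -1` and the splitting of `f` and its
    -- derivative into real and imaginary parts.
    generalize (1 : ℂ) ⊗ₜ[ℝ] rePart S x = p
    generalize (1 : ℂ) ⊗ₜ[ℝ] imPart S x = q
    generalize (1 : ℂ) ⊗ₜ[ℝ] D (rePart S) x (X x) = a
    generalize (1 : ℂ) ⊗ₜ[ℝ] D (imPart S) x (X x) = b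
    generalize ((f x).re : ℂ) = r at *
    generalize ((f x).im : ℂ) = i at *
    generalize mvfderiv 𝓘(ℝ, E) f x (X x) = d at *
    rw [hf0]
    linear_combination (norm := module) (-(d.im : ℂ) * hI) • q - (i * hI) • b
      - hf1 • (p + Complex.I • q)
  have h : ∀ L : TC E x →ₗ[ℂ] TC E x, L v =
      L ((1 : ℂ) ⊗ₜ[ℝ] re E x v) + Complex.I • L ((1 : ℂ) ⊗ₜ[ℝ] im E x v) := by
    intro L
    rw [← map_smul, ← map_add, tmul_re_add_tmul_im]
  rw [h, h (covC D S x), key, key, dC]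
  module

end

/-! ### Type projections and complexified covariant derivatives of vector fields. -/

section

variable {E : Type*} [NormedAddCommGroup E] [NormedSpace ℂ E]
  {M : Type*} [TopologicalSpace M] [ChartedSpace E M]

/-- `I Z` for a complex vector field `Z`. -/
def applyIC (Z : CVF E M) : CVF E M := fun x => IC x (Z x)

theorem rePart_applyIC (Z : CVF E M) : rePart (applyIC Z) = applyI (rePart Z) := by
  funext x
  change re E x (IC x (Z x)) = cplxStr E x (re E x (Z x))
  conv_lhs => rw [← tmul_re_add_tmul_im x (Z x)]
  simp [re_smul]

theorem imPart_applyIC (Z : CVF E M) : imPart (applyIC Z) = applyI (imPart Z) := by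
  funext x
  change im E x (IC x (Z x)) = cplxStr E x (im E x (Z x))
  conv_lhs => rw [← tmul_re_add_tmul_im x (Z x)]
  simp [im_smul]

theorem proj10_eq (Z : CVF E M) :
    proj10 Z = (1 / 2 : ℂ) • (Z + (-Complex.I) • applyIC Z) := by
  funext x
  change (1 / 2 : ℂ) • (Z x - Complex.I • IC x (Z x)) =
    (1 / 2 : ℂ) • (Z x + (-Complex.I) • IC x (Z x))
  module

theorem proj01_eq (Z : CVF E M) :
    proj01 Z = (1 / 2 : ℂ) • (Z + Complex.I • applyIC Z) := rfl

theorem proj10_add_proj01 (Z : CVF E M) : proj10 Z + proj01 Z = Z :=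
  funext fun x => pi10_add_pi01 x (Z x)

theorem T10_T01_disjoint {x : M} {v : TC E x} (h : v ∈ T10 E x) (h' : v ∈ T01 E x) : v = 0 := by
  rw [← pi10_of_mem h, pi10_of_mem_T01 h']

theorem act_add (α : EndForm1 E M) (W S S' : CVF E M) :
    α.act W (S + S') = α.act W S + α.act W S' :=
  funext fun x => map_add (α x (W x)) (S x) (S' x)

theorem act_smul (α : EndForm1 E M) (c : ℂ) (W S : CVF E M) :
    α.act W (c • S) = c • α.act W S :=
  funext fun x => map_smul (α x (W x)) c (S x)

theorem act_add_left (α : EndForm1 E M) (W W' S : CVF E M) :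
    α.act (W + W') S = α.act W S + α.act W' S :=
  funext fun x => by simp [EndForm1.act]

theorem act_smul_left (α : EndForm1 E M) (c : ℂ) (W S : CVF E M) :
    α.act (c • W) S = c • α.act W S :=
  funext fun x => by simp [EndForm1.act]

theorem act_sub_left (α : EndForm1 E M) (W W' S : CVF E M) :
    α.act (W - W') S = α.act W S - α.act W' S :=
  funext fun x => by simp [EndForm1.act]

variable [IsManifold 𝓘(ℂ, E) ω M]

theorem SmoothCVF.applyIC {Z : CVF E M} (hZ : SmoothCVF Z) : SmoothCVF (applyIC Z) :=
  SmoothCVF.mk (by rw [rePart_applyIC]; exact hZ.rePart.applyI)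
    (by rw [imPart_applyIC]; exact hZ.imPart.applyI)

theorem SmoothCVF.proj10 {Z : CVF E M} (hZ : SmoothCVF Z) : SmoothCVF (proj10 Z) := by
  rw [proj10_eq]
  exact (hZ.add (hZ.applyIC.smul _)).smul _

theorem SmoothCVF.proj01 {Z : CVF E M} (hZ : SmoothCVF Z) : SmoothCVF (proj01 Z) := by
  rw [proj01_eq]
  exact (hZ.add (hZ.applyIC.smul _)).smul _

theorem alongC_add (D : Conn E M) (Z : CVF E M) {S S' : CVF E M} (hS : SmoothCVF S)
    (hS' : SmoothCVF S') : alongC D Z (S + S') = alongC D Z S + alongC D Z S' :=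
  funext fun x => congrArg (fun L => L (Z x)) (covC_add D hS hS' x)

theorem covC_smul (D : Conn E M) (c : ℂ) {S : CVF E M} (hS : SmoothCVF S) (x : M) (v : TC E x) :
    covC D (c • S) x v = c • covC D S x v := by
  have h := covC_fun_smul D (f := fun _ => c) contMDiff_const hS x v
  have h0 : dC (fun _ : M => c) x v = 0 := by simp [dC, mvfderiv_const]
  rw [h0, zero_smul, zero_add] at h
  exact h

theorem alongC_smul (D : Conn E M) (Z : CVF E M) (c : ℂ) {S : CVF E M} (hS : SmoothCVF S) :
    alongC D Z (c • S) = c • alongC D Z S :=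
  funext fun x => covC_smul D c hS x (Z x)

theorem alongC_add_left (D : Conn E M) (Z Z' S : CVF E M) :
    alongC D (Z + Z') S = alongC D Z S + alongC D Z' S :=
  funext fun x => map_add (covC D S x) (Z x) (Z' x)

theorem alongC_smul_left (D : Conn E M) (c : ℂ) (Z S : CVF E M) :
    alongC D (c • Z) S = c • alongC D Z S :=
  funext fun x => map_smul (covC D S x) c (Z x)

/-- Separating real and imaginary parts lets smoothness, the torsion identity and commutation with
`I` be inherited from the real connection. -/
theorem alongC_eq (D : Conn E M) (Z S : CVF E M) : alongC D Z S =
    ofReal (along D (rePart Z) (rePart S) - along D (imPart Z) (imPart S)) +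
      Complex.I • ofReal (along D (rePart Z) (imPart S) + along D (imPart Z) (rePart S)) := by
  funext x
  change covC D S x (Z x) = (1 : ℂ) ⊗ₜ[ℝ] (D (rePart S) x (rePart Z x) -
    D (imPart S) x (imPart Z x)) + Complex.I • (1 : ℂ) ⊗ₜ[ℝ] (D (imPart S) x (rePart Z x) +
      D (rePart S) x (imPart Z x))
  rw [← tmul_re_add_tmul_im x (Z x), map_add, map_smul, covC_tmul, covC_tmul,
    TensorProduct.tmul_add, TensorProduct.tmul_sub]
  linear_combination (norm := (simp only [rePart, imPart]; module))
    Complex.I_mul_I • (1 : ℂ) ⊗ₜ[ℝ] D (imPart S) x (im E x (Z x))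

theorem along_zero (D : Conn E M) (X : VF E M) : along D X 0 = 0 := by
  funext x
  change D 0 x (X x) = 0
  rw [D.zero]
  rfl

theorem along_zero_left (D : Conn E M) (X : VF E M) : along D 0 X = 0 :=
  funext fun x => map_zero (D X x)

theorem alongC_ofReal (D : Conn E M) (X Y : VF E M) :
    alongC D (ofReal X) (ofReal Y) = ofReal (along D X Y) := by
  rw [alongC_eq]
  simp only [rePart_ofReal, imPart_ofReal, along_zero, along_zero_left, sub_zero, add_zero,
    ofReal_zero, smul_zero]

variable {D : Conn E M}

theorem SmoothCVF.alongC (hD : CovariantDerivative.ContMDiffCovariantDerivative D ∞)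
    {Z S : CVF E M} (hZ : SmoothCVF Z) (hS : SmoothCVF S) : SmoothCVF (alongC D Z S) := by
  rw [alongC_eq]
  exact ((hZ.rePart.along hD hS.rePart).sub (hZ.imPart.along hD hS.imPart)).ofReal.add
    (((hZ.rePart.along hD hS.imPart).add (hZ.imPart.along hD hS.rePart)).ofReal.smul _)

variable [FiniteDimensional ℂ E]

/-- With brackets eliminated in favour of `D`, all later 2-forms become visibly trilinear
expressions, which may be tested on real fields. -/
theorem IsTorsionFree.bracketC_eq (hD : IsTorsionFree D) {Z W : CVF E M} (hZ : SmoothCVF Z)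
    (hW : SmoothCVF W) : bracketC Z W = alongC D Z W - alongC D W Z := by
  have h : bracketC Z W = ofReal (bracket (rePart Z) (rePart W) - bracket (imPart Z) (imPart W)) +
      Complex.I • ofReal (bracket (rePart Z) (imPart W) + bracket (imPart Z) (rePart W)) := by
    funext x
    change _ = _ + Complex.I • (1 : ℂ) ⊗ₜ[ℝ] (bracket (rePart Z) (imPart W) x +
      bracket (imPart Z) (rePart W) x)
    rw [TensorProduct.smul_tmul', smul_eq_mul, mul_one]
    rfl
  rw [h, alongC_eq, alongC_eq, ← hD.along_sub_along hZ.rePart hW.rePart,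
    ← hD.along_sub_along hZ.imPart hW.imPart, ← hD.along_sub_along hZ.rePart hW.imPart,
    ← hD.along_sub_along hZ.imPart hW.rePart]
  simp only [ofReal_add, ofReal_sub]
  module

/-! ### The complex bilinear extension of `nabla - D` -/

variable {nabla : Conn E M} {Ω : BilinField E M}

theorem diffForm_tmul (nabla D : Conn E M) (x : M) (v w : TangentSpace 𝓘(ℝ, E) x) :
    diffForm nabla D x ((1 : ℂ) ⊗ₜ[ℝ] v) ((1 : ℂ) ⊗ₜ[ℝ] w) =
      (1 : ℂ) ⊗ₜ[ℝ] nabla.difference D x w v := by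
  simp [diffForm]

theorem diffForm_act_ofReal (nabla D : Conn E M) (X Y : VF E M) :
    (diffForm nabla D).act (ofReal X) (ofReal Y) = ofReal (diffAct nabla D X Y) :=
  funext fun x => diffForm_tmul nabla D x (X x) (Y x)

theorem SmoothCVF.diffForm_act (hN : CovariantDerivative.ContMDiffCovariantDerivative nabla ∞)
    (hD : CovariantDerivative.ContMDiffCovariantDerivative D ∞) {Z S : CVF E M}
    (hZ : SmoothCVF Z) (hS : SmoothCVF S) : SmoothCVF ((diffForm nabla D).act Z S) := by
  rw [← ofReal_rePart_add Z, ← ofReal_rePart_add S, act_add, act_add_left, act_add_left,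
    act_smul, act_smul, act_smul_left, act_smul_left]
  simp only [diffForm_act_ofReal]
  exact ((hZ.rePart.diffAct hN hD hS.rePart).ofReal.add
    ((hZ.imPart.diffAct hN hD hS.rePart).ofReal.smul _)).add
    (((hZ.rePart.diffAct hN hD hS.imPart).ofReal.smul _).add
      (((hZ.imPart.diffAct hN hD hS.imPart).ofReal.smul _).smul _))

theorem diffForm_conjTC (nabla D : Conn E M) (x : M) (v w : TC E x) :
    conjTC E x (diffForm nabla D x (conjTC E x v) (conjTC E x w)) = diffForm nabla D x v w := by
  induction v using TC_induction with
  | h u =>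
    induction w using TC_induction with
    | h w =>
      have h : ∀ u : TangentSpace 𝓘(ℝ, E) x,
          conjTC E x ((1 : ℂ) ⊗ₜ[ℝ] u) = (1 : ℂ) ⊗ₜ[ℝ] u := by
        intro u
        simp [conjTC]
      rw [h, h, diffForm_tmul, h]
    | hadd v w hv hw => simp only [map_add, hv, hw]
    | hsmul c v hv => rw [conjTC_smul, map_smul, conjTC_smul, hv, Complex.conj_conj, map_smul]
  | hadd v w hv hw => simp only [map_add, LinearMap.add_apply, hv, hw]
  | hsmul c v hv =>
    rw [conjTC_smul, map_smul, map_smul, LinearMap.smul_apply, LinearMap.smul_apply, conjTC_smul,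
      hv, Complex.conj_conj]

theorem higgsForm_apply (nabla D : Conn E M) (x : M) (v w : TC E x) :
    higgsForm nabla D x v w = diffForm nabla D x (pi10 E x v) w := rfl

/-- The form `nabla - D` is real and conjugation exchanges the two projections, so `Ā` is its
`(0,1)`-component. -/
theorem higgsForm_conj_apply (nabla D : Conn E M) (x : M) (v w : TC E x) :
    (higgsForm nabla D).conj x v w = diffForm nabla D x (pi01 E x v) w := by
  change conjTC E x (diffForm nabla D x (pi10 E x (conjTC E x v)) (conjTC E x w)) = _
  rw [pi10_conjTC, diffForm_conjTC]

theorem diffForm_eq_add (nabla D : Conn E M) :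
    diffForm nabla D = higgsForm nabla D + (higgsForm nabla D).conj := by
  funext x
  refine LinearMap.ext fun v => LinearMap.ext fun w => ?_
  change _ = higgsForm nabla D x v w + (higgsForm nabla D).conj x v w
  rw [higgsForm_conj_apply, higgsForm_apply, ← LinearMap.add_apply, ← map_add, pi10_add_pi01]

variable [T2Space M]

theorem IsSpecialKahler.diffForm_symm (hM : IsSpecialKahler Ω nabla)
    (hD : IsLeviCivita (kahlerMetric Ω) D) (x : M) (v w : TC E x) :
    diffForm nabla D x v w = diffForm nabla D x w v := by
  induction v using TC_induction with
  | h u =>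
    induction w using TC_induction with
    | h w => rw [diffForm_tmul, diffForm_tmul, hM.difference_symm hD]
    | hadd v w hv hw => simp only [map_add, LinearMap.add_apply, hv, hw]
    | hsmul c v hv => rw [map_smul, map_smul, LinearMap.smul_apply, hv]
  | hadd v w hv hw => simp only [map_add, LinearMap.add_apply, hv, hw]
  | hsmul c v hv => rw [map_smul, map_smul, LinearMap.smul_apply, hv]

theorem IsSpecialKahler.diffForm_IC (hM : IsSpecialKahler Ω nabla)
    (hD : IsLeviCivita (kahlerMetric Ω) D) (x : M) (v w : TC E x) :
    diffForm nabla D x v (IC x w) = -IC x (diffForm nabla D x v w) := by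
  induction v using TC_induction with
  | h u =>
    induction w using TC_induction with
    | h w =>
      rw [LinearMap.baseChange_tmul, diffForm_tmul, diffForm_tmul, hM.difference_cplxStr hD,
        LinearMap.baseChange_tmul, TensorProduct.tmul_neg]
    | hadd v w hv hw => simp only [map_add, hv, hw]; abel
    | hsmul c v hv => simp only [map_smul, hv, smul_neg]
  | hadd v w hv hw => simp only [map_add, LinearMap.add_apply, hv, hw]; abel
  | hsmul c v hv => simp only [map_smul, LinearMap.smul_apply, hv, smul_neg]

theorem IsSpecialKahler.diffForm_mem_T01 (hM : IsSpecialKahler Ω nabla)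
    (hD : IsLeviCivita (kahlerMetric Ω) D) {x : M} (v : TC E x) {w : TC E x} (hw : w ∈ T10 E x) :
    diffForm nabla D x v w ∈ T01 E x := by
  rw [mem_T01, ← map_smul, ← mem_T10.1 hw, hM.diffForm_IC hD, neg_neg]

theorem IsSpecialKahler.diffForm_mem_T10 (hM : IsSpecialKahler Ω nabla)
    (hD : IsLeviCivita (kahlerMetric Ω) D) {x : M} (v : TC E x) {w : TC E x} (hw : w ∈ T01 E x) :
    diffForm nabla D x v w ∈ T10 E x := by
  have h := hM.diffForm_IC hD x v w
  rw [mem_T01.1 hw, map_neg, map_smul, neg_inj] at h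
  exact mem_T10.2 h.symm

/-- Anticommutation with `I` puts the value in `T^{1,0}`; symmetry followed by anticommutation puts
it in `T^{0,1}`. -/
theorem IsSpecialKahler.diffForm_T10_T01 (hM : IsSpecialKahler Ω nabla)
    (hD : IsLeviCivita (kahlerMetric Ω) D) {x : M} {v w : TC E x} (hv : v ∈ T10 E x)
    (hw : w ∈ T01 E x) : diffForm nabla D x v w = 0 :=
  T10_T01_disjoint (hM.diffForm_mem_T10 hD v hw)
    (by rw [hM.diffForm_symm hD]; exact hM.diffForm_mem_T01 hD w hv)

theorem IsSpecialKahler.diffForm_T01_T10 (hM : IsSpecialKahler Ω nabla)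
    (hD : IsLeviCivita (kahlerMetric Ω) D) {x : M} {v w : TC E x} (hv : v ∈ T01 E x)
    (hw : w ∈ T10 E x) : diffForm nabla D x v w = 0 := by
  rw [hM.diffForm_symm hD, hM.diffForm_T10_T01 hD hw hv]

/-! ### `D` preserves the type of vector fields -/

theorem IsSpecialKahler.alongC_applyIC (hM : IsSpecialKahler Ω nabla)
    (hD : IsLeviCivita (kahlerMetric Ω) D) {Z S : CVF E M} (hZ : SmoothCVF Z) (hS : SmoothCVF S) :
    alongC D Z (applyIC S) = applyIC (alongC D Z S) := by
  have h : ∀ X Y : VF E M, applyIC (ofReal X + Complex.I • ofReal Y) =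
      ofReal (applyI X) + Complex.I • ofReal (applyI Y) := by
    intro X Y
    funext x
    change IC x ((1 : ℂ) ⊗ₜ[ℝ] X x + Complex.I • (1 : ℂ) ⊗ₜ[ℝ] Y x) = _
    rw [map_add, map_smul]
    rfl
  rw [alongC_eq, alongC_eq, rePart_applyIC, imPart_applyIC, h, applyI_sub, applyI_add,
    hM.along_applyI hD hZ.rePart hS.rePart, hM.along_applyI hD hZ.rePart hS.imPart,
    hM.along_applyI hD hZ.imPart hS.rePart, hM.along_applyI hD hZ.imPart hS.imPart]

theorem IsSpecialKahler.alongC_proj10 (hM : IsSpecialKahler Ω nabla)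
    (hD : IsLeviCivita (kahlerMetric Ω) D) {Z S : CVF E M} (hZ : SmoothCVF Z) (hS : SmoothCVF S) :
    alongC D Z (proj10 S) = proj10 (alongC D Z S) := by
  rw [proj10_eq, proj10_eq, alongC_smul _ _ _ (hS.add (hS.applyIC.smul _)),
    alongC_add _ _ hS (hS.applyIC.smul _), alongC_smul _ _ _ hS.applyIC,
    hM.alongC_applyIC hD hZ hS]

theorem IsSpecialKahler.alongC_proj01 (hM : IsSpecialKahler Ω nabla)
    (hD : IsLeviCivita (kahlerMetric Ω) D) {Z S : CVF E M} (hZ : SmoothCVF Z) (hS : SmoothCVF S) :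
    alongC D Z (proj01 S) = proj01 (alongC D Z S) := by
  rw [proj01_eq, proj01_eq, alongC_smul _ _ _ (hS.add (hS.applyIC.smul _)),
    alongC_add _ _ hS (hS.applyIC.smul _), alongC_smul _ _ _ hS.applyIC,
    hM.alongC_applyIC hD hZ hS]

theorem IsSpecialKahler.alongC_mem_T10 (hM : IsSpecialKahler Ω nabla)
    (hD : IsLeviCivita (kahlerMetric Ω) D) {Z S : CVF E M} (hZ : SmoothCVF Z) (hS : SmoothCVF S)
    (h : ∀ x, S x ∈ T10 E x) (x : M) : alongC D Z S x ∈ T10 E x := by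
  have h1 : proj10 S = S := funext fun x => pi10_of_mem (h x)
  rw [← h1, hM.alongC_proj10 hD hZ hS]
  exact pi10_mem x _

theorem IsSpecialKahler.alongC_mem_T01 (hM : IsSpecialKahler Ω nabla)
    (hD : IsLeviCivita (kahlerMetric Ω) D) {Z S : CVF E M} (hZ : SmoothCVF Z) (hS : SmoothCVF S)
    (h : ∀ x, S x ∈ T01 E x) (x : M) : alongC D Z S x ∈ T01 E x := by
  have h1 : proj01 S = S := funext fun x => pi01_of_mem (h x)
  rw [← h1, hM.alongC_proj01 hD hZ hS]
  exact pi01_mem x _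

end

section

variable {E : Type*} [NormedAddCommGroup E] [NormedSpace ℂ E]
  {M : Type*} [TopologicalSpace M] [ChartedSpace E M] [IsManifold 𝓘(ℂ, E) ω M]
  {D nabla : Conn E M} {Ω : BilinField E M}

/-! ### The covariant derivative of `nabla - D` -/

/-- The covariant derivative `(D_Z α)_W S` of a 1-form `α` with values in `End(T^ℂ M)`. -/
def covForm (D : Conn E M) (α : EndForm1 E M) : EndForm2 E M := fun Z W S =>
  alongC D Z (α.act W S) - α.act (alongC D Z W) S - α.act W (alongC D Z S)

theorem covForm_isTrilinear (D : Conn E M) {α : EndForm1 E M}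
    (hα : ∀ {Z S : CVF E M}, SmoothCVF Z → SmoothCVF S → SmoothCVF (α.act Z S)) :
    (covForm D α).IsTrilinear where
  add₁ _ _ _ _ := by
    simp only [covForm, alongC_add_left, act_add, act_add_left]
    abel
  smul₁ c _ _ _ _ _ _ := by
    simp only [covForm, alongC_smul_left, act_smul, act_smul_left]
    module
  add₂ _ hW hW' hS := by
    rw [covForm, act_add_left, alongC_add D _ (hα hW hS) (hα hW' hS), alongC_add D _ hW hW',
      act_add_left, act_add_left]
    simp only [covForm]
    abel
  smul₂ c _ _ _ _ hW hS := by
    rw [covForm, act_smul_left, alongC_smul D _ c (hα hW hS), alongC_smul D _ c hW,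
      act_smul_left, act_smul_left]
    simp only [covForm]
    module
  add₃ _ hW hS hS' := by
    rw [covForm, act_add, alongC_add D _ (hα hW hS) (hα hW hS'), alongC_add D _ hS hS',
      act_add, act_add]
    simp only [covForm]
    abel
  smul₃ c _ _ _ _ hW hS := by
    rw [covForm, act_smul, alongC_smul D _ c (hα hW hS), alongC_smul D _ c hS,
      act_smul, act_smul]
    simp only [covForm]
    module

theorem EndForm2.IsTrilinear.add {F G : EndForm2 E M} (hF : F.IsTrilinear) (hG : G.IsTrilinear) :
    (F + G).IsTrilinear where
  add₁ h1 h2 h3 h4 := by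
    simp only [Pi.add_apply, hF.add₁ h1 h2 h3 h4, hG.add₁ h1 h2 h3 h4]; abel
  smul₁ c _ _ _ h1 h2 h3 := by
    simp only [Pi.add_apply, hF.smul₁ c h1 h2 h3, hG.smul₁ c h1 h2 h3, smul_add]
  add₂ h1 h2 h3 h4 := by
    simp only [Pi.add_apply, hF.add₂ h1 h2 h3 h4, hG.add₂ h1 h2 h3 h4]; abel
  smul₂ c _ _ _ h1 h2 h3 := by
    simp only [Pi.add_apply, hF.smul₂ c h1 h2 h3, hG.smul₂ c h1 h2 h3, smul_add]
  add₃ h1 h2 h3 h4 := by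
    simp only [Pi.add_apply, hF.add₃ h1 h2 h3 h4, hG.add₃ h1 h2 h3 h4]; abel
  smul₃ c _ _ _ h1 h2 h3 := by
    simp only [Pi.add_apply, hF.smul₃ c h1 h2 h3, hG.smul₃ c h1 h2 h3, smul_add]

theorem EndForm2.IsTrilinear.sub_swap {F : EndForm2 E M} (hF : F.IsTrilinear) :
    EndForm2.IsTrilinear (fun Z W S => F Z W S - F W Z S) where
  add₁ h1 h2 h3 h4 := by
    simp only [hF.add₁ h1 h2 h3 h4, hF.add₂ h3 h1 h2 h4]; abel
  smul₁ c _ _ _ h1 h2 h3 := by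
    simp only [hF.smul₁ c h1 h2 h3, hF.smul₂ c h2 h1 h3, smul_sub]
  add₂ h1 h2 h3 h4 := by
    simp only [hF.add₂ h1 h2 h3 h4, hF.add₁ h2 h3 h1 h4]; abel
  smul₂ c _ _ _ h1 h2 h3 := by
    simp only [hF.smul₂ c h1 h2 h3, hF.smul₁ c h2 h1 h3, smul_sub]
  add₃ h1 h2 h3 h4 := by
    simp only [hF.add₃ h1 h2 h3 h4, hF.add₃ h2 h1 h3 h4]; abel
  smul₃ c _ _ _ h1 h2 h3 := by
    simp only [hF.smul₃ c h1 h2 h3, hF.smul₃ c h2 h1 h3, smul_sub]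

theorem wedge_isTrilinear (α β : EndForm1 E M) : (wedge α β).IsTrilinear where
  add₁ _ _ _ _ := by
    funext x
    simp only [wedge, wedgeAt, Pi.add_apply, map_add, LinearMap.sub_apply, LinearMap.comp_apply,
      LinearMap.add_apply]
    abel
  smul₁ _ _ _ _ _ _ _ := by
    funext x
    simp only [wedge, wedgeAt, Pi.smul_apply, map_smul, LinearMap.sub_apply, LinearMap.comp_apply,
      LinearMap.smul_apply, smul_sub]
  add₂ _ _ _ _ := by
    funext x
    simp only [wedge, wedgeAt, Pi.add_apply, map_add, LinearMap.sub_apply, LinearMap.comp_apply,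
      LinearMap.add_apply]
    abel
  smul₂ _ _ _ _ _ _ _ := by
    funext x
    simp only [wedge, wedgeAt, Pi.smul_apply, map_smul, LinearMap.sub_apply, LinearMap.comp_apply,
      LinearMap.smul_apply, smul_sub]
  add₃ _ _ _ _ := by
    funext x
    simp only [wedge, Pi.add_apply, map_add]
  smul₃ _ _ _ _ _ _ _ := by
    funext x
    simp only [wedge, Pi.smul_apply, map_smul]

/-- The second covariant derivative of the connection `D`: the part
`D_Z D_W S - D_{D_Z W} S` of its curvature. -/
def hessC (D : Conn E M) : EndForm2 E M := fun Z W S =>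
  alongC D Z (alongC D W S) - alongC D (alongC D Z W) S

theorem hessC_isTrilinear (hD : CovariantDerivative.ContMDiffCovariantDerivative D ∞) :
    (hessC D).IsTrilinear where
  add₁ _ _ _ _ := by
    simp only [hessC, alongC_add_left]
    abel
  smul₁ c _ _ _ _ _ _ := by
    simp only [hessC, alongC_smul_left]
    module
  add₂ _ hW hW' hS := by
    rw [hessC, alongC_add_left, alongC_add D _ (hW.alongC hD hS) (hW'.alongC hD hS),
      alongC_add D _ hW hW', alongC_add_left]
    simp only [hessC]
    abel
  smul₂ c _ _ _ _ hW hS := by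
    rw [hessC, alongC_smul_left, alongC_smul D _ c (hW.alongC hD hS), alongC_smul D _ c hW,
      alongC_smul_left]
    simp only [hessC]
    module
  add₃ _ hW hS hS' := by
    rw [hessC, alongC_add D _ hS hS', alongC_add D _ (hW.alongC hD hS) (hW.alongC hD hS'),
      alongC_add D _ hS hS']
    simp only [hessC]
    abel
  smul₃ c _ _ _ _ hW hS := by
    rw [hessC, alongC_smul D _ c hS, alongC_smul D _ c (hW.alongC hD hS), alongC_smul D _ c hS]
    simp only [hessC]
    module

variable [FiniteDimensional ℂ E]

/-- The curvature is the skew part of the second covariant derivative, whose trilinearity does not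
involve the bracket. -/
theorem IsTorsionFree.curvC_eq (hD : IsTorsionFree D) {Z W : CVF E M} (S : CVF E M)
    (hZ : SmoothCVF Z) (hW : SmoothCVF W) : curvC D Z W S = hessC D Z W S - hessC D W Z S := by
  have h : ∀ A B : CVF E M, alongC D (A - B) S = alongC D A S - alongC D B S := fun A B =>
    funext fun x => map_sub (covC D S x) (A x) (B x)
  rw [curvC, hessC, hessC, hD.bracketC_eq hZ hW, h]
  abel

theorem bracketC_ofReal (hD : IsTorsionFree D) {X Y : VF E M} (hX : SmoothVF X)
    (hY : SmoothVF Y) : bracketC (ofReal X) (ofReal Y) = ofReal (bracket X Y) := by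
  rw [hD.bracketC_eq hX.ofReal hY.ofReal, alongC_ofReal, alongC_ofReal, ← ofReal_sub,
    hD.along_sub_along hX hY]

/-- `d_D (a ∘ P)` for `a = nabla - D` and a parallel endomorphism `P` of `T^ℂ M`. -/
theorem IsTorsionFree.extCov_comp (hD : IsTorsionFree D)
    {α : EndForm1 E M} {P : CVF E M → CVF E M}
    (hα : ∀ W S, α.act W S = (diffForm nabla D).act (P W) S)
    (hP : ∀ {Z W}, SmoothCVF Z → SmoothCVF W → alongC D Z (P W) = P (alongC D Z W))
    {Z W : CVF E M} (hZ : SmoothCVF Z) (hW : SmoothCVF W) (S : CVF E M) :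
    extCov D α Z W S = covForm D (diffForm nabla D) Z (P W) S -
      covForm D (diffForm nabla D) W (P Z) S := by
  -- Once the bracket is `D_Z W - D_W Z` and `P` commutes with `D`, the terms regroup into two
  -- covariant derivatives of `a`.
  rw [extCov, hD.bracketC_eq hZ hW, act_sub_left]
  simp only [hα, covForm, hP hZ hW, hP hW hZ]
  abel

variable [T2Space M]

/-- `R_D + a ∧ a = 0` for `a = nabla - D`. -/
theorem IsSpecialKahler.curvC_add_wedge (hM : IsSpecialKahler Ω nabla)
    (hD : IsLeviCivita (kahlerMetric Ω) D) :
    (curvC D + wedge (diffForm nabla D) (diffForm nabla D)).Vanishes := by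
  have h : EndForm2.Vanishes ((fun Z W S => hessC D Z W S - hessC D W Z S) +
      wedge (diffForm nabla D) (diffForm nabla D)) := by
    refine ((hessC_isTrilinear hD.smooth).sub_swap.add (wedge_isTrilinear _ _)).vanishes ?_
    intro X Y S hX hY hS
    change hessC D _ _ _ - hessC D _ _ _ + _ = 0
    rw [← hD.torsionFree.curvC_eq _ hX.ofReal hY.ofReal, curvC,
      bracketC_ofReal hD.torsionFree hX hY]
    simp only [alongC_ofReal]
    have h2 : wedge (diffForm nabla D) (diffForm nabla D) (ofReal X) (ofReal Y) (ofReal S) =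
        (diffForm nabla D).act (ofReal X) ((diffForm nabla D).act (ofReal Y) (ofReal S)) -
        (diffForm nabla D).act (ofReal Y) ((diffForm nabla D).act (ofReal X) (ofReal S)) := rfl
    rw [h2]
    simp only [diffForm_act_ofReal, ← ofReal_sub, ← ofReal_add]
    rw [← ofReal_zero, ← hM.curvDiff_eq_zero hD hX hY hS, curvDiff, curv, add_sub_assoc]
  intro Z W S hZ hW hS
  rw [← h Z W S hZ hW hS]
  change curvC D Z W S + _ = (hessC D Z W S - hessC D W Z S) + _
  rw [hD.torsionFree.curvC_eq S hZ hW]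

/-- For torsion-free `D` this is the equation `d_D a = 0`, extended from real to complex fields. -/
theorem IsSpecialKahler.covForm_symm (hM : IsSpecialKahler Ω nabla)
    (hD : IsLeviCivita (kahlerMetric Ω) D) {Z W S : CVF E M} (hZ : SmoothCVF Z)
    (hW : SmoothCVF W) (hS : SmoothCVF S) :
    covForm D (diffForm nabla D) Z W S = covForm D (diffForm nabla D) W Z S := by
  have h : EndForm2.Vanishes (fun Z W S : CVF E M =>
      covForm D (diffForm nabla D) Z W S - covForm D (diffForm nabla D) W Z S) := by
    refine (covForm_isTrilinear D (SmoothCVF.diffForm_act hM.smooth hD.smooth)).sub_swap.vanishes ?_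
    intro X Y S hX hY hS
    simp only [covForm, alongC_ofReal, diffForm_act_ofReal, ← ofReal_sub]
    rw [← ofReal_zero, ← hM.extCovDiff_eq_zero hD hX hY hS, extCovDiff,
      ← hD.torsionFree.along_sub_along hX hY]
    congr 1
    have h2 : ∀ A B : VF E M, diffAct nabla D (A - B) S =
        diffAct nabla D A S - diffAct nabla D B S := fun A B =>
      funext fun x => map_sub (nabla.difference D x (S x)) (A x) (B x)
    rw [h2]
    abel
  exact sub_eq_zero.1 (h Z W S hZ hW hS)

theorem IsSpecialKahler.act_symm (hM : IsSpecialKahler Ω nabla)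
    (hD : IsLeviCivita (kahlerMetric Ω) D) (W S : CVF E M) :
    (diffForm nabla D).act W S = (diffForm nabla D).act S W :=
  funext fun x => hM.diffForm_symm hD x (W x) (S x)

theorem IsSpecialKahler.covForm_symm_right (hM : IsSpecialKahler Ω nabla)
    (hD : IsLeviCivita (kahlerMetric Ω) D) (Z W S : CVF E M) :
    covForm D (diffForm nabla D) Z W S = covForm D (diffForm nabla D) Z S W := by
  rw [covForm, covForm, hM.act_symm hD W S, hM.act_symm hD _ S, hM.act_symm hD W]
  abel

/-- Since `D` preserves types, each of the three terms of `(D_Z a)_W S` evaluates `a` on a pair of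
opposite types. -/
theorem IsSpecialKahler.covForm_right_mixed (hM : IsSpecialKahler Ω nabla)
    (hD : IsLeviCivita (kahlerMetric Ω) D) {Z W S : CVF E M} (hZ : SmoothCVF Z)
    (hW : SmoothCVF W) (hS : SmoothCVF S) (hW' : ∀ x, W x ∈ T10 E x)
    (hS' : ∀ x, S x ∈ T01 E x) : covForm D (diffForm nabla D) Z W S = 0 := by
  have h : ∀ A B : CVF E M, (∀ x, A x ∈ T10 E x) → (∀ x, B x ∈ T01 E x) →
      (diffForm nabla D).act A B = 0 := fun A B hA hB =>
    funext fun x => hM.diffForm_T10_T01 hD (hA x) (hB x)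
  have h0 : alongC D Z 0 = 0 := by
    simpa using alongC_smul D Z 0 hW
  rw [covForm, h W S hW' hS', h _ S (hM.alongC_mem_T10 hD hZ hW hW') hS',
    h W _ hW' (hM.alongC_mem_T01 hD hZ hS hS'), h0]
  simp

/-- The totally symmetric tensor `D a`, `a = nabla - D`, vanishes on vectors of mixed type. -/
theorem IsSpecialKahler.covForm_mixed (hM : IsSpecialKahler Ω nabla)
    (hD : IsLeviCivita (kahlerMetric Ω) D) {Z W S : CVF E M} (hZ : SmoothCVF Z)
    (hW : SmoothCVF W) (hS : SmoothCVF S) (hZ' : ∀ x, Z x ∈ T10 E x)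
    (hW' : ∀ x, W x ∈ T01 E x) : covForm D (diffForm nabla D) Z W S = 0 := by
  have h := covForm_isTrilinear D (SmoothCVF.diffForm_act hM.smooth hD.smooth)
  -- Whatever the type of `S`, a permutation of the slots puts two arguments of opposite types last:
  -- `S^{1,0}` pairs with `W`, and `S^{0,1}` with `Z`.
  have h1 : covForm D (diffForm nabla D) Z W (proj10 S) = 0 := by
    rw [hM.covForm_symm_right hD]
    exact hM.covForm_right_mixed hD hZ hS.proj10 hW (fun x => pi10_mem x _) hW'
  have h2 : covForm D (diffForm nabla D) Z W (proj01 S) = 0 := by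
    rw [hM.covForm_symm hD hZ hW hS.proj01]
    exact hM.covForm_right_mixed hD hW hZ hS.proj01 hZ' (fun x => pi01_mem x _)
  rw [← proj10_add_proj01 S, h.add₃ hZ hW hS.proj10 hS.proj01, h1, h2, add_zero]

end

/-! ### The equations for `A` and `Ā`, the holomorphic structure and the Higgs field. -/

section

variable {E : Type*} [NormedAddCommGroup E] [NormedSpace ℂ E]
  {M : Type*} [TopologicalSpace M] [ChartedSpace E M]

theorem proj10_mem (Z : CVF E M) (x : M) : proj10 Z x ∈ T10 E x := pi10_mem x (Z x)

theorem proj01_mem (Z : CVF E M) (x : M) : proj01 Z x ∈ T01 E x := pi01_mem x (Z x)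

theorem proj10_proj10 (Z : CVF E M) : proj10 (proj10 Z) = proj10 Z :=
  funext fun x => pi10_of_mem (proj10_mem Z x)

theorem proj01_proj01 (Z : CVF E M) : proj01 (proj01 Z) = proj01 Z :=
  funext fun x => pi01_of_mem (proj01_mem Z x)

theorem proj10_proj01 (Z : CVF E M) : proj10 (proj01 Z) = 0 :=
  funext fun x => pi10_of_mem_T01 (proj01_mem Z x)

theorem proj01_proj10 (Z : CVF E M) : proj01 (proj10 Z) = 0 :=
  funext fun x => pi01_of_mem_T10 (proj10_mem Z x)

variable [IsManifold 𝓘(ℂ, E) ω M] {D nabla : Conn E M} {Ω : BilinField E M}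

theorem alongC_zero (D : Conn E M) (Z : CVF E M) : alongC D Z 0 = 0 := by
  simpa using alongC_smul D Z 0 smoothVF_zero.ofReal

theorem covForm_zero (D : Conn E M) (α : EndForm1 E M) (Z S : CVF E M) :
    covForm D α Z 0 S = 0 := by
  have h : ∀ S, α.act 0 S = 0 := fun S => by simpa using act_smul_left α 0 0 S
  rw [covForm, alongC_zero, h, h, alongC_zero, sub_zero, sub_zero]

theorem cov01_eq_alongC (D : Conn E M) (S : CVF E M) {Z : CVF E M} (hZ : ∀ x, Z x ∈ T01 E x) :
    (fun x => cov01 D S x (Z x)) = alongC D Z S := by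
  funext x
  change covC D S x (pi01 E x (Z x)) = _
  rw [pi01_of_mem (hZ x)]
  rfl

variable [FiniteDimensional ℂ E]

theorem extCov_zero (hD : IsTorsionFree D) {α : EndForm1 E M} (hα : ∀ W S, α.act W S = 0)
    {Z W : CVF E M} (hZ : SmoothCVF Z) (hW : SmoothCVF W) (S : CVF E M) :
    extCov D α Z W S = 0 := by
  -- A form with zero action is `a` composed with `P = 0`; the auxiliary connection is therefore
  -- immaterial.
  rw [hD.extCov_comp (nabla := D) (P := fun _ => 0) ?_ (fun _ _ => alongC_zero D _) hZ hW,
    covForm_zero, covForm_zero, sub_zero]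
  intro W S
  rw [hα]
  simpa using (act_smul_left (diffForm D D) 0 0 S).symm

theorem higgsForm_part10_act (nabla D : Conn E M) (W S : CVF E M) :
    (higgsForm nabla D).part10.act W S = (diffForm nabla D).act (proj10 W) S := by
  conv_rhs => rw [← proj10_proj10]
  rfl

theorem higgsForm_part01_act (nabla D : Conn E M) (W S : CVF E M) :
    (higgsForm nabla D).part01.act W S = 0 := by
  have h : (higgsForm nabla D).part01.act W S =
    (diffForm nabla D).act (proj10 (proj01 W)) S := rfl
  rw [h, proj10_proj01]
  simpa using act_smul_left (diffForm nabla D) 0 0 S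

theorem higgsForm_conj_part01_act (nabla D : Conn E M) (W S : CVF E M) :
    (higgsForm nabla D).conj.part01.act W S = (diffForm nabla D).act (proj01 W) S := by
  conv_rhs => rw [← proj01_proj01]
  exact funext fun x => higgsForm_conj_apply nabla D x _ _

theorem higgsForm_conj_part10_act (nabla D : Conn E M) (W S : CVF E M) :
    (higgsForm nabla D).conj.part10.act W S = 0 := by
  have h : (higgsForm nabla D).conj.part10.act W S =
    (diffForm nabla D).act (proj01 (proj10 W)) S :=
    funext fun x => higgsForm_conj_apply nabla D x _ _
  rw [h, proj01_proj10]
  simpa using act_smul_left (diffForm nabla D) 0 0 S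

variable [T2Space M]

section Equations

variable (hM : IsSpecialKahler Ω nabla) (hD : IsLeviCivita (kahlerMetric Ω) D)
include hM hD

theorem IsSpecialKahler.extCov_part10 {Z W : CVF E M} (hZ : SmoothCVF Z) (hW : SmoothCVF W)
    (S : CVF E M) : extCov D (higgsForm nabla D).part10 Z W S =
      covForm D (diffForm nabla D) Z (proj10 W) S - covForm D (diffForm nabla D) W (proj10 Z) S :=
  hD.torsionFree.extCov_comp (higgsForm_part10_act nabla D)
    (fun h1 h2 => hM.alongC_proj10 hD h1 h2) hZ hW S

theorem IsSpecialKahler.extCov_conj_part01 {Z W : CVF E M} (hZ : SmoothCVF Z) (hW : SmoothCVF W)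
    (S : CVF E M) : extCov D (higgsForm nabla D).conj.part01 Z W S =
      covForm D (diffForm nabla D) Z (proj01 W) S - covForm D (diffForm nabla D) W (proj01 Z) S :=
  hD.torsionFree.extCov_comp (higgsForm_conj_part01_act nabla D)
    (fun h1 h2 => hM.alongC_proj01 hD h1 h2) hZ hW S

theorem IsSpecialKahler.covForm_mixed' {Z W S : CVF E M} (hZ : SmoothCVF Z)
    (hW : SmoothCVF W) (hS : SmoothCVF S) (hZ' : ∀ x, Z x ∈ T01 E x)
    (hW' : ∀ x, W x ∈ T10 E x) : covForm D (diffForm nabla D) Z W S = 0 := by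
  rw [hM.covForm_symm hD hZ hW hS, hM.covForm_mixed hD hW hZ hS hW' hZ']

/-- On two `(1,0)` arguments `d_D A` is the antisymmetrization of the symmetric tensor `D a`. -/
theorem IsSpecialKahler.del_higgsForm : (del D (higgsForm nabla D)).Vanishes := by
  intro Z W S hZ hW hS
  have h0 := fun {Z W : CVF E M} (hZ : SmoothCVF Z) (hW : SmoothCVF W) =>
    extCov_zero hD.torsionFree (higgsForm_part01_act nabla D) hZ hW S
  simp only [del, EndForm2.part20, EndForm2.part11, Pi.add_apply]
  rw [h0 hZ.proj10 hW.proj01, h0 hZ.proj01 hW.proj10, hM.extCov_part10 hD hZ.proj10 hW.proj10,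
    proj10_proj10, proj10_proj10, hM.covForm_symm hD hZ.proj10 hW.proj10 hS]
  simp

theorem IsSpecialKahler.delbar_higgsForm_conj :
    (delbar D (higgsForm nabla D).conj).Vanishes := by
  intro Z W S hZ hW hS
  have h0 := fun {Z W : CVF E M} (hZ : SmoothCVF Z) (hW : SmoothCVF W) =>
    extCov_zero hD.torsionFree (higgsForm_conj_part10_act nabla D) hZ hW S
  simp only [delbar, EndForm2.part02, EndForm2.part11, Pi.add_apply]
  rw [h0 hZ.proj10 hW.proj01, h0 hZ.proj01 hW.proj10,
    hM.extCov_conj_part01 hD hZ.proj01 hW.proj01,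
    proj01_proj01, proj01_proj01, hM.covForm_symm hD hZ.proj01 hW.proj01 hS]
  simp

/-- The projection to `(1,0)` leaves in each mixed component a single value of `D a`, taken on form
arguments of opposite types. -/
theorem IsSpecialKahler.delbar_higgsForm : (delbar D (higgsForm nabla D)).Vanishes := by
  intro Z W S hZ hW hS
  simp only [delbar, EndForm2.part02, EndForm2.part11, Pi.add_apply]
  rw [extCov_zero hD.torsionFree (higgsForm_part01_act nabla D) hZ.proj01 hW.proj01,
    hM.extCov_part10 hD hZ.proj10 hW.proj01, hM.extCov_part10 hD hZ.proj01 hW.proj10,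
    proj10_proj01, proj10_proj01, proj10_proj10, proj10_proj10, covForm_zero, covForm_zero,
    hM.covForm_mixed' hD hW.proj01 hZ.proj10 hS (proj01_mem W) (proj10_mem Z),
    hM.covForm_mixed' hD hZ.proj01 hW.proj10 hS (proj01_mem Z) (proj10_mem W)]
  simp

theorem IsSpecialKahler.del_higgsForm_conj : (del D (higgsForm nabla D).conj).Vanishes := by
  intro Z W S hZ hW hS
  simp only [del, EndForm2.part20, EndForm2.part11, Pi.add_apply]
  rw [extCov_zero hD.torsionFree (higgsForm_conj_part10_act nabla D) hZ.proj10 hW.proj10,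
    hM.extCov_conj_part01 hD hZ.proj10 hW.proj01, hM.extCov_conj_part01 hD hZ.proj01 hW.proj10,
    proj01_proj10, proj01_proj10, proj01_proj01, proj01_proj01, covForm_zero, covForm_zero,
    hM.covForm_mixed hD hW.proj10 hZ.proj01 hS (proj10_mem W) (proj01_mem Z),
    hM.covForm_mixed hD hZ.proj10 hW.proj01 hS (proj10_mem Z) (proj01_mem W)]
  simp

theorem IsSpecialKahler.higgsForm_mem_T01 {x : M} (v : TC E x) {w : TC E x}
    (hw : w ∈ T10 E x) : higgsForm nabla D x v w ∈ T01 E x :=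
  hM.diffForm_mem_T01 hD _ hw

theorem IsSpecialKahler.higgsForm_T01 {x : M} (v : TC E x) {w : TC E x}
    (hw : w ∈ T01 E x) : higgsForm nabla D x v w = 0 :=
  hM.diffForm_T10_T01 hD (pi10_mem x v) hw

/-- By symmetry the inner value is `a_s w`, of type `(0,1)`, which `a_v` kills. This is the source
of `A ∧ A = 0`. -/
theorem IsSpecialKahler.diffForm_T10_diffForm_T10 {x : M} {v w : TC E x} (s : TC E x)
    (hv : v ∈ T10 E x) (hw : w ∈ T10 E x) :
    diffForm nabla D x v (diffForm nabla D x w s) = 0 := by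
  rw [hM.diffForm_symm hD x w s]
  exact hM.diffForm_T10_T01 hD hv (hM.diffForm_mem_T01 hD s hw)

theorem IsSpecialKahler.diffForm_T01_diffForm_T01 {x : M} {v w : TC E x} (s : TC E x)
    (hv : v ∈ T01 E x) (hw : w ∈ T01 E x) :
    diffForm nabla D x v (diffForm nabla D x w s) = 0 := by
  rw [hM.diffForm_symm hD x w s]
  exact hM.diffForm_T01_T10 hD hv (hM.diffForm_mem_T10 hD s hw)

theorem IsSpecialKahler.wedge_higgsForm_self (x : M) (v w : TC E x) :
    wedgeAt (higgsForm nabla D) (higgsForm nabla D) x v w = 0 := by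
  refine LinearMap.ext fun s => ?_
  change diffForm nabla D x (pi10 E x v) (diffForm nabla D x (pi10 E x w) s) -
    diffForm nabla D x (pi10 E x w) (diffForm nabla D x (pi10 E x v) s) = 0
  rw [hM.diffForm_T10_diffForm_T10 hD s (pi10_mem x v) (pi10_mem x w),
    hM.diffForm_T10_diffForm_T10 hD s (pi10_mem x w) (pi10_mem x v), sub_zero]

/-- Expanding `a = A + Ā`, the pure products vanish and only the cross terms survive. -/
theorem IsSpecialKahler.wedge_higgsForm_add :
    wedge (higgsForm nabla D) (higgsForm nabla D).conj +
      wedge (higgsForm nabla D).conj (higgsForm nabla D) =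
    wedge (diffForm nabla D) (diffForm nabla D) := by
  funext Z W S x
  generalize hv : Z x = v
  generalize hw : W x = w
  generalize hs : S x = s
  have h10 : ∀ v w, diffForm nabla D x (pi10 E x v) (diffForm nabla D x (pi10 E x w) s) = 0 :=
    fun v w => hM.diffForm_T10_diffForm_T10 hD s (pi10_mem x v) (pi10_mem x w)
  have h01 : ∀ v w, diffForm nabla D x (pi01 E x v) (diffForm nabla D x (pi01 E x w) s) = 0 :=
    fun v w => hM.diffForm_T01_diffForm_T01 hD s (pi01_mem x v) (pi01_mem x w)
  simp only [Pi.add_apply, wedge, wedgeAt, LinearMap.sub_apply, LinearMap.comp_apply, hv, hw, hs,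
    higgsForm_apply, higgsForm_conj_apply]
  conv_rhs => rw [← pi10_add_pi01 x v, ← pi10_add_pi01 x w]
  simp only [map_add, LinearMap.add_apply, h10, h01]
  abel

theorem IsSpecialKahler.curvC_add_wedge_higgsForm :
    (curvC D + wedge (higgsForm nabla D) (higgsForm nabla D).conj +
      wedge (higgsForm nabla D).conj (higgsForm nabla D)).Vanishes := by
  rw [add_assoc, hM.wedge_higgsForm_add hD]
  exact hM.curvC_add_wedge hD

theorem IsSpecialKahler.bracketC_mem_T01 {Z W : CVF E M} (hZ : SmoothCVF Z) (hW : SmoothCVF W)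
    (hZ' : ∀ x, Z x ∈ T01 E x) (hW' : ∀ x, W x ∈ T01 E x) (x : M) :
    bracketC Z W x ∈ T01 E x := by
  rw [hD.torsionFree.bracketC_eq hZ hW]
  exact (T01 E x).sub_mem (hM.alongC_mem_T01 hD hZ hW hW' x) (hM.alongC_mem_T01 hD hW hZ hZ' x)

/-- In `[Z, W] = D_Z W - D_W Z` the first term has type `(1,0)` and the second type `(0,1)`. -/
theorem IsSpecialKahler.pi10_bracketC {Z W : CVF E M} (hZ : SmoothCVF Z) (hW : SmoothCVF W)
    (hZ' : ∀ x, Z x ∈ T01 E x) (hW' : ∀ x, W x ∈ T10 E x) (x : M) :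
    pi10 E x (bracketC Z W x) = alongC D Z W x := by
  rw [hD.torsionFree.bracketC_eq hZ hW, Pi.sub_apply, map_sub,
    pi10_of_mem (hM.alongC_mem_T10 hD hZ hW hW' x),
    pi10_of_mem_T01 (hM.alongC_mem_T01 hD hW hZ hZ' x), sub_zero]

theorem IsSpecialKahler.isHolomorphicStructure : IsHolomorphicStructure (cov01 D) where
  type01 S _ x v hv := by
    change covC D S x (pi01 E x v) = 0
    rw [pi01_of_mem_T10 hv, map_zero]
  smooth S Z hS hZ := hZ.proj01.alongC hD.smooth hS
  add S S' hS hS' := by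
    funext x
    change covC D (S + S') x ∘ₗ _ = covC D S x ∘ₗ _ + covC D S' x ∘ₗ _
    rw [covC_add D hS hS' x, LinearMap.add_comp]
  leibniz f S hf hS x v hv := by
    change covC D _ x (pi01 E x v) = _ + _ • covC D S x (pi01 E x v)
    rw [pi01_of_mem hv, covC_fun_smul D hf hS]
  integrable Z W S hZ hW hS hZ' hW' x := by
    have hc : ∀ v, v ∈ T01 E x → ∀ S, cov01 D S x v = covC D S x v := by
      intro v hv S
      change covC D S x (pi01 E x v) = _
      rw [pi01_of_mem hv]
    rw [cov01_eq_alongC D S hW', cov01_eq_alongC D S hZ', hc _ (hZ' x), hc _ (hW' x),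
      hc _ (hM.bracketC_mem_T01 hD hZ hW hZ' hW' x)]
    -- Integrability is the vanishing of `R_D = -a ∧ a` on two `(0,1)` arguments, where `a ∧ a` is
    -- zero.
    have h := congrFun (hM.curvC_add_wedge hD Z W S hZ hW hS) x
    have h2 : wedge (diffForm nabla D) (diffForm nabla D) Z W S x = 0 := by
      change diffForm nabla D x (Z x) (diffForm nabla D x (W x) (S x)) -
        diffForm nabla D x (W x) (diffForm nabla D x (Z x) (S x)) = 0
      rw [hM.diffForm_T01_diffForm_T01 hD _ (hZ' x) (hW' x),
        hM.diffForm_T01_diffForm_T01 hD _ (hW' x) (hZ' x), sub_zero]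
    change curvC D Z W S x + wedge (diffForm nabla D) (diffForm nabla D) Z W S x = 0 at h
    rwa [h2, add_zero] at h

theorem IsSpecialKahler.isHiggsField : IsHiggsField (cov01 D) (higgsForm nabla D) where
  type10 x v hv := by
    refine LinearMap.ext fun w => ?_
    rw [higgsForm_apply, pi10_of_mem_T01 hv, map_zero]
  smooth Z S hZ hS := SmoothCVF.diffForm_act hM.smooth hD.smooth hZ.proj10 hS
  holomorphic Z W S hZ hW hS hZ' hW' x := by
    have hact : (higgsForm nabla D).act W S = (diffForm nabla D).act W S := by
      funext x
      change diffForm nabla D x (pi10 E x (W x)) (S x) = _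
      rw [pi10_of_mem (hW' x)]
      rfl
    have hmem := hM.alongC_mem_T10 hD hZ hW hW' x
    have e := congrFun (cov01_eq_alongC D ((higgsForm nabla D).act W S) hZ') x
    have e' := congrFun (cov01_eq_alongC D S hZ') x
    rw [e, e', hM.pi10_bracketC hD hZ hW hZ' hW', hact, higgsForm_apply, higgsForm_apply,
      pi10_of_mem (hW' x), pi10_of_mem hmem]
    -- With the projected bracket replaced by `D_Z W`, the holomorphy condition is `(D_Z a)_W S = 0`
    -- for `Z` of type `(0,1)` and `W` of type `(1,0)`.
    have h := congrFun (hM.covForm_mixed' hD hZ hW hS hZ' hW') x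
    rw [← sub_right_comm]
    exact h
  wedge_self := hM.wedge_higgsForm_self hD

end Equations

end

end

end SpecialKahler

theorem mainTheorem5
    {E : Type*} [NormedAddCommGroup E] [NormedSpace ℂ E] [FiniteDimensional ℂ E]
    {M : Type*} [TopologicalSpace M] [T2Space M] [ChartedSpace E M] [IsManifold 𝓘(ℂ, E) ω M]
    (Ω : SpecialKahler.BilinField E M) (nabla D : SpecialKahler.Conn E M)
    (hM : SpecialKahler.IsSpecialKahler Ω nabla)
    (hD : SpecialKahler.IsLeviCivita (SpecialKahler.kahlerMetric Ω) D)
    (A Abar : SpecialKahler.EndForm1 E M)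
    (hA : A = SpecialKahler.higgsForm nabla D) (hAbar : Abar = A.conj) :
    -- `nabla - D = A + Ā`, and `A` is a `(1,0)`-form with values in `Hom(T^{1,0}, T^{0,1})`
    SpecialKahler.diffForm nabla D = A + Abar ∧
    (∀ x, ∀ v ∈ SpecialKahler.T01 E x, A x v = 0) ∧
    (∀ x v, ∀ w ∈ SpecialKahler.T10 E x, A x v w ∈ SpecialKahler.T01 E x) ∧
    (∀ x v, ∀ w ∈ SpecialKahler.T01 E x, A x v w = 0) ∧
    -- the equations
    (SpecialKahler.del D A).Vanishes ∧
    (SpecialKahler.delbar D Abar).Vanishes ∧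
    (SpecialKahler.delbar D A).Vanishes ∧
    (SpecialKahler.del D Abar).Vanishes ∧
    SpecialKahler.EndForm2.Vanishes
      (SpecialKahler.curvC D + SpecialKahler.wedge A Abar + SpecialKahler.wedge Abar A) ∧
    -- `D^{0,1}` is a holomorphic structure on `T^ℂ M`, which on `T^{1,0}` is the usual one of the
    -- holomorphic tangent bundle, and `A` is a Higgs field for it
    SpecialKahler.IsHolomorphicStructure (SpecialKahler.cov01 D) ∧
    (∀ Z W : SpecialKahler.CVF E M, SpecialKahler.SmoothCVF Z → SpecialKahler.SmoothCVF W →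
      (∀ x, Z x ∈ SpecialKahler.T01 E x) → (∀ x, W x ∈ SpecialKahler.T10 E x) → ∀ x,
      SpecialKahler.cov01 D W x (Z x) =
        SpecialKahler.pi10 E x (SpecialKahler.bracketC Z W x)) ∧
    SpecialKahler.IsHiggsField (SpecialKahler.cov01 D) A := by
  subst hA hAbar
  refine ⟨SpecialKahler.diffForm_eq_add nabla D, (hM.isHiggsField hD).type10,
    fun _ v _ hw => hM.higgsForm_mem_T01 hD v hw, fun _ v _ hw => hM.higgsForm_T01 hD v hw,
    hM.del_higgsForm hD, hM.delbar_higgsForm_conj hD, hM.delbar_higgsForm hD,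
    hM.del_higgsForm_conj hD, hM.curvC_add_wedge_higgsForm hD, hM.isHolomorphicStructure hD, ?_,
    hM.isHiggsField hD⟩
  intro Z W hZ hW hZ' hW' x
  rw [hM.pi10_bracketC hD hZ hW hZ' hW']
  exact congrFun (SpecialKahler.cov01_eq_alongC D W hZ') x
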